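/- For $m\ge 0$ and a skew-symmetric $\Theta\in M_m(\mathbb R)$ let $A_\Theta$ be the noncommutative torus, i.e. the universal unital $C^*$-algebra generated by unitaries $U_1,\dots,U_m$ with $U_kU_j=e^{2\pi i\Theta_{j,k}}U_jU_k$, and put $U^x=U_1^{x_1}\cdots U_m^{x_m}$ for $x\in\mathbb Z^m$. Call $\Theta$ nondegenerate if $x=0$ is the only $x\in\mathbb Z^m$ with $e^{2\pi i\langle x,\Theta y\rangle}=1$ for all $y\in\mathbb Z^m$. The GNS space of the canonical trace is $L^2(A_\Theta,\tau_\Theta)=\ell^2(\mathbb Z^m)$, with $\delta_x=\Lambda(U^x)$, where $\Lambda(a)$ denotes the GNS vector of $a\in A_\Theta$. For a Hilbert space $S$, $A_\Theta$ acts on $L^2(A_\Theta,\tau_\Theta)\otimes S$ by the left regular representation on the first factor. A *spectral triple* $(A,H,D)$ on a unital $C^*$-algebra $A$ consists of a faithful unital representation $\pi\colon A\to\mathcal B(H)$ and a selfadjoint operator $D$ on $H$ with compact resolvent such that $A^\infty(D)=\{a\in A:[D,\pi(a)]\text{ is densely defined and extends to a bounded operator}\}$ is dense in $A$. For a set $G$,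 a nonzero finite-dimensional complex Hilbert space $S$ and $F\colon G\to\mathrm{End}(S)_{\mathrm{sa}}$, let $D_F$ be the diagonal operator $(\xi_g)_g\mapsto(F(g)\xi_g)_g$ on $\ell^2(G)\otimes S=\bigoplus_{g\in G}S$ with domain $\{(\xi_g)_g:\sum_g\|F(g)\xi_g\|^2<\infty\}$. When $G$ is an abelian group consider the conditions (a) for every $R>0$ the vector space $\bigoplus_{g\in G,\ \mathrm{Spec}(F(g))\cap[-R,R]\ne\varnothing}S$ is finite-dimensional; (b) for every $h\in G$, $\sup_{g\in G}\|F(g+h)-F(g)\|<\infty$. Let $\Theta_n\in M_{m_n}(\mathbb R)$ ($n\ge1$) be nondegenerate skew-symmetric matrices, $M_n\in M_{m_{n+1}\times m_n}(\mathbb Z)$ and $z_n\in\mathbb T^{m_n}$ such that $\Theta_n-M_n^t\Theta_{n+1}M_n$ is an integer skew-symmetric matrix. Let $A_n=A_{\Theta_n}$ and let $\varphi_n\colon A_n\to A_{n+1}$ be the unital $*$-homomorphism that sends the $j$-th generator of $A_n$ to $(z_n)_jV^{M_ne_j}$, where $V^y$ ($y\in\mathbb Z^{m_{n+1}}$) are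 the ordered monomials in the generators of $A_{n+1}$. Fix a nonzero finite-dimensional complex Hilbert space $S$ and functions $F_n\colon\mathbb Z^{m_n}\to\mathrm{End}(S)_{\mathrm{sa}}$ satisfying (a) and (b) (with $G=\mathbb Z^{m_n}$) and $F_{n+1}(M_nx)=F_n(x)$ for all $n$ and all $x\in\mathbb Z^{m_n}$. Put $H_n=L^2(A_n,\tau_n)\otimes S=\ell^2(\mathbb Z^{m_n})\otimes S$ and $D_n=D_{F_n}$, and assume $\varphi_n(A_n^\infty(D_n))\subseteq A_{n+1}^\infty(D_{n+1})$ for all $n$. Let $G_\infty=\varinjlim(\mathbb Z^{m_n},M_n)$, and let $[x,n]\in G_\infty$ be the class of $x\in\mathbb Z^{m_n}$. Then: 1. $F_\infty([x,n])=F_n(x)$ defines a function $F_\infty\colon G_\infty\to\mathrm{End}(S)_{\mathrm{sa}}$. 2. There are unique isometries $I_n\colon H_n\to H_{n+1}$ with $I_n(\Lambda_n(a)\otimes\xi)=\Lambda_{n+1}(\varphi_n(a))\otimes\xi$ for $a\in A_n$, $\xi\in S$. Let $A_{\mathrm{pro}}=\varinjlim(A_n,\varphi_n)$ (as $C^*$-algebra)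 and $H_{\mathrm{pro}}=\varinjlim(H_n,I_n)$ (as Hilbert space), with canonical maps $\iota_n\colon A_n\to A_{\mathrm{pro}}$ and $\jmath_n\colon H_n\to H_{\mathrm{pro}}$. The prescription $\jmath_n\eta\mapsto\jmath_nD_n\eta$ ($\eta\in\mathrm{Dom}(D_n)$) is a well-defined, densely defined, closable operator on $\bigcup_n\jmath_n(\mathrm{Dom}(D_n))$; let $D_{\mathrm{pro}}$ be its closure. There is a unique unital representation of $A_{\mathrm{pro}}$ on $H_{\mathrm{pro}}$ in which $\iota_n(a)\jmath_n\eta=\jmath_n(a\eta)$ for all $n$, $a\in A_n$, $\eta\in H_n$. 3. There are a unitary $V\colon H_{\mathrm{pro}}\to\ell^2(G_\infty)\otimes S$ and phases $\chi_n(x)\in\mathbb T$ with $V\jmath_n(\delta_x\otimes\xi)=\chi_n(x)\,\delta_{[x,n]}\otimes\xi$ for all $n$, $x\in\mathbb Z^{m_n}$, $\xi\in S$, and $VD_{\mathrm{pro}}V^*=D_{F_\infty}$ (equality of domains included). 4. If $F_\infty$ satisfies (a) and (b) with $G=G_\infty$, then the inductive realization $(A_{\mathrm{pro}},H_{\mathrm{pro}},D_{\mathrm{pro}})$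 is a spectral triple on $A_{\mathrm{pro}}$. -/

import Mathlib

open scoped ENNReal Matrix

noncomputable section

namespace Protorus

/-! ### Noncommutative tori as universal C⋆-algebras -/

instance lpInftyCStarAlgebra {ι : Type*} {A : ι → Type*} [∀ i, Nontrivial (A i)]
    [∀ i, CStarAlgebra (A i)] : CStarAlgebra (lp A ∞) where

/-- `e t = exp (2π i t)` as a point of the unit circle. -/
def e (t : ℝ) : Circle := Circle.exp (2 * Real.pi * t)

lemma e_add (s t : ℝ) : e (s + t) = e s * e t := by
  simp [e, mul_add, Circle.exp_add]

lemma e_zero : e 0 = 1 := by simp [e]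

lemma e_neg (t : ℝ) : e (-t) = (e t)⁻¹ := by
  simp [e, Circle.exp_neg]

lemma e_int (k : ℤ) : e k = 1 := by
  rw [e, mul_comm, Circle.exp_eq_one]
  exact ⟨k, rfl⟩

/-- Scalars of modulus one as unitaries of a unital C⋆-algebra. -/
def scalarUnitary (B : Type*) [CStarAlgebra B] : Circle →* unitary B where
  toFun z := ⟨algebraMap ℂ B z, by
    rw [Unitary.mem_iff, ← algebraMap_star_comm, ← map_mul, ← map_mul]
    simp [← Circle.coe_inv_eq_conj]⟩
  map_one' := by ext; simp
  map_mul' z w := by ext; simp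

lemma scalarUnitary_comm {B : Type*} [CStarAlgebra B] (z : Circle) (b : unitary B) :
    scalarUnitary B z * b = b * scalarUnitary B z := by
  ext
  exact Algebra.commutes (z : ℂ) (b : B)

/-- The relations `u_k u_j = exp(2π i Θ_{j,k}) u_j u_k` for a family of unitaries. -/
def TorusRelations {m : ℕ} (Θ : Matrix (Fin m) (Fin m) ℝ) {B : Type*} [CStarAlgebra B]
    (u : Fin m → unitary B) : Prop :=
  ∀ j k, (u k : B) * u j = (e (Θ j k) : ℂ) • ((u j : B) * u k)

/-- The ordered monomial `u^x = u_1^{x_1} ⋯ u_m^{x_m}`. -/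
def monomial {m : ℕ} {G : Type*} [Group G] (u : Fin m → G) (x : Fin m → ℤ) : G :=
  (List.ofFn fun i => u i ^ x i).prod

lemma map_monomial {m : ℕ} {G G' : Type*} [Group G] [Group G'] (f : G →* G') (u : Fin m → G)
    (x : Fin m → ℤ) : f (monomial u x) = monomial (fun i => f (u i)) x := by
  simp [monomial, map_list_prod, List.map_ofFn, Function.comp_def]

/-- The map induced on unitary groups by a unital ⋆-homomorphism. -/
def unitaryMap {A B : Type*} [CStarAlgebra A] [CStarAlgebra B] (f : A →⋆ₐ[ℂ] B) :
    unitary A →* unitary B where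
  toFun u := ⟨f u, by
    rw [Unitary.mem_iff, ← map_star, ← map_mul, ← map_mul]
    simp⟩
  map_one' := by ext; simp
  map_mul' u v := by ext; simp

/-- A nonzero unital C⋆-algebra with unitaries satisfying the relations of the noncommutative
torus with parameter `Θ`. -/
structure TorusModel {m : ℕ} (Θ : Matrix (Fin m) (Fin m) ℝ) where
  B : Type
  [cstar : CStarAlgebra B]
  [nontrivial : Nontrivial B]
  u : Fin m → unitary B
  rel : TorusRelations Θ u

attribute [instance] TorusModel.cstar TorusModel.nontrivial

/-- The family of all the `j`-th unitaries of all models, as a unitary in the product. -/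
def tautologicalUnitary {m : ℕ} (Θ : Matrix (Fin m) (Fin m) ℝ) (j : Fin m) :
    unitary (lp (fun r : TorusModel Θ => r.B) ∞) :=
  ⟨⟨fun r => (r.u j : r.B), memℓp_infty ⟨1, by
      rintro _ ⟨r, rfl⟩
      exact (CStarRing.norm_coe_unitary (r.u j)).le⟩⟩, by
    rw [Unitary.mem_iff]
    constructor <;> ext r <;> simp [lp.infty_coeFn_mul]⟩

/-- The noncommutative torus `A_Θ`: the universal unital C⋆-algebra generated by unitaries
`U_1, …, U_m` with `U_k U_j = exp(2π i Θ_{j,k}) U_j U_k`, realized in the usual way as the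
C⋆-subalgebra generated by the tautological unitaries in the product of all models. (A C⋆-algebra
generated by finitely many elements is isomorphic to one in `Type`, so that no model is missed.) -/
def NCTorus {m : ℕ} (Θ : Matrix (Fin m) (Fin m) ℝ) :
    StarSubalgebra ℂ (lp (fun r : TorusModel Θ => r.B) ∞) :=
  (StarAlgebra.adjoin ℂ
    (Set.range fun j => (tautologicalUnitary Θ j : lp (fun r : TorusModel Θ => r.B) ∞))
    ).topologicalClosure

instance {m : ℕ} (Θ : Matrix (Fin m) (Fin m) ℝ) :
    IsClosed (NCTorus Θ : Set (lp (fun r : TorusModel Θ => r.B) ∞)) :=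
  StarSubalgebra.isClosed_topologicalClosure _

/-- The canonical generators of `A_Θ`. -/
def NCTorus.U {m : ℕ} (Θ : Matrix (Fin m) (Fin m) ℝ) (j : Fin m) : unitary (NCTorus Θ) :=
  ⟨⟨tautologicalUnitary Θ j,
      StarSubalgebra.le_topologicalClosure _ (StarAlgebra.subset_adjoin ℂ _ ⟨j, rfl⟩)⟩, by
    rw [Unitary.mem_iff]
    constructor <;> ext1
    · exact (Unitary.mem_iff.1 (tautologicalUnitary Θ j).2).1
    · exact (Unitary.mem_iff.1 (tautologicalUnitary Θ j).2).2⟩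

/-- Evaluation of the product of all models at one of them. -/
def evalProd {m : ℕ} {Θ : Matrix (Fin m) (Fin m) ℝ} (r : TorusModel Θ) :
    lp (fun r : TorusModel Θ => r.B) ∞ →⋆ₐ[ℂ] r.B where
  toFun f := f r
  map_one' := rfl
  map_mul' _ _ := rfl
  map_zero' := rfl
  map_add' _ _ := rfl
  commutes' _ := rfl
  map_star' _ := rfl

/-- The homomorphism `A_Θ → B` given by the universal property of `A_Θ`. -/
def NCTorus.lift {m : ℕ} {Θ : Matrix (Fin m) (Fin m) ℝ} (r : TorusModel Θ) :
    NCTorus Θ →⋆ₐ[ℂ] r.B :=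
  (evalProd r).comp (NCTorus Θ).subtype

lemma NCTorus.lift_U {m : ℕ} {Θ : Matrix (Fin m) (Fin m) ℝ} (r : TorusModel Θ) (j : Fin m) :
    NCTorus.lift r (NCTorus.U Θ j : NCTorus Θ) = r.u j := rfl

/-! ### Toric homomorphisms -/

lemma monomial_comm {m : ℕ} {B : Type*} [CStarAlgebra B] (u : Fin m → unitary B) (b : unitary B)
    (t : Fin m → ℝ) (h : ∀ k, u k * b = scalarUnitary B (e (t k)) * (b * u k))
    (y : Fin m → ℤ) :
    monomial u y * b = scalarUnitary B (e (∑ k, y k * t k)) * (b * monomial u y) := by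
  let P : Subgroup (unitary B × Multiplicative ℝ) :=
    { carrier := {p | p.1 * b = scalarUnitary B (e p.2.toAdd) * (b * p.1)}
      one_mem' := by simp [e_zero]
      mul_mem' := by
        rintro ⟨p, s⟩ ⟨q, t⟩ hp hq
        simp only [Set.mem_ofPred_eq, Prod.mk_mul_mk, toAdd_mul, e_add, map_mul] at *
        rw [mul_assoc, hq, ← mul_assoc, ← scalarUnitary_comm, mul_assoc, ← mul_assoc p, hp]
        simp only [← mul_assoc]
        rw [scalarUnitary_comm]
      inv_mem' := by
        rintro ⟨p, s⟩ hp
        simp only [Set.mem_ofPred_eq, Prod.inv_mk, toAdd_inv, e_neg, map_inv] at *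
        rw [inv_mul_eq_iff_eq_mul, ← mul_assoc, ← mul_assoc, eq_mul_inv_iff_mul_eq,
          ← map_inv, ← scalarUnitary_comm, mul_assoc, hp, map_inv, inv_mul_cancel_left] }
  have hP : monomial (fun k => ((u k, Multiplicative.ofAdd (t k)) :
      unitary B × Multiplicative ℝ)) y ∈ P :=
    Subgroup.list_prod_mem _ (by
      intro a ha
      obtain ⟨i, rfl⟩ := List.mem_ofFn.1 ha
      exact P.zpow_mem (h i) _)
  have h1 := map_monomial (MonoidHom.fst (unitary B) (Multiplicative ℝ))
    (fun k => (u k, Multiplicative.ofAdd (t k))) y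
  have h2 := map_monomial (MonoidHom.snd (unitary B) (Multiplicative ℝ))
    (fun k => (u k, Multiplicative.ofAdd (t k))) y
  have h3 : (monomial (fun k => Multiplicative.ofAdd (t k)) y).toAdd = ∑ k, y k * t k := by
    simp [monomial, List.prod_ofFn, toAdd_prod]
  have h4 : _ * b = scalarUnitary B (e (Multiplicative.toAdd _)) * (b * _) := hP
  simp only [MonoidHom.coe_fst, MonoidHom.coe_snd] at h1 h2
  rwa [h1, h2, h3] at h4

lemma TorusRelations.group {m : ℕ} {Θ : Matrix (Fin m) (Fin m) ℝ} {B : Type*} [CStarAlgebra B]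
    {u : Fin m → unitary B} :
    TorusRelations Θ u ↔ ∀ j k, u k * u j = scalarUnitary B (e (Θ j k)) * (u j * u k) := by
  refine forall₂_congr fun j k => ?_
  rw [Subtype.ext_iff]
  simp [scalarUnitary, Algebra.smul_def]

lemma comm_symm {B : Type*} [CStarAlgebra B] {a b : unitary B} {t : ℝ}
    (h : a * b = scalarUnitary B (e t) * (b * a)) :
    b * a = scalarUnitary B (e (-t)) * (a * b) := by
  rw [h, e_neg, map_inv, inv_mul_cancel_left]

/-- `u^y u^x = exp(2π i ⟨x, Θ y⟩) u^x u^y`. -/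
lemma TorusRelations.monomial_mul {m : ℕ} {Θ : Matrix (Fin m) (Fin m) ℝ} {B : Type*}
    [CStarAlgebra B] {u : Fin m → unitary B} (h : TorusRelations Θ u) (x y : Fin m → ℤ) :
    monomial u y * monomial u x =
      scalarUnitary B (e (∑ j, x j * ∑ k, y k * Θ j k)) * (monomial u x * monomial u y) := by
  have h1 : ∀ j, monomial u y * u j =
      scalarUnitary B (e (∑ k, y k * Θ j k)) * (u j * monomial u y) := fun j =>
    monomial_comm u (u j) (fun k => Θ j k) (fun k => TorusRelations.group.1 h j k) y
  have h2 := comm_symm (monomial_comm u (monomial u y) _ (fun j => comm_symm (h1 j)) x)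
  simpa using h2

/-- `Θ ≡ Mᵗ Ψ M` modulo integer-valued skew-symmetric matrices. -/
def ToricCongruence {m n : ℕ} (Θ : Matrix (Fin m) (Fin m) ℝ) (Ψ : Matrix (Fin n) (Fin n) ℝ)
    (M : Matrix (Fin n) (Fin m) ℤ) : Prop :=
  ∃ K : Matrix (Fin m) (Fin m) ℤ, Kᵀ = -K ∧
    Θ - (M.map (Int.cast : ℤ → ℝ))ᵀ * Ψ * M.map (Int.cast : ℤ → ℝ) = K.map (Int.cast : ℤ → ℝ)

/-- The unitaries `z_j V^{M e_j}` in a model of `A_Ψ` form a model of `A_Θ`. -/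
def TorusModel.pullback {m n : ℕ} {Θ : Matrix (Fin m) (Fin m) ℝ} {Ψ : Matrix (Fin n) (Fin n) ℝ}
    {M : Matrix (Fin n) (Fin m) ℤ} (z : Fin m → Circle) (h : ToricCongruence Θ Ψ M)
    (r : TorusModel Ψ) : TorusModel Θ where
  B := r.B
  u j := scalarUnitary r.B (z j) * monomial r.u (fun i => M i j)
  rel := by
    obtain ⟨K, -, hK⟩ := h
    rw [TorusRelations.group]
    intro j k
    have key : e (Θ j k) = e (∑ p, M p j * ∑ q, M q k * Ψ p q) := by
      have h1 := congrFun (congrFun hK j) k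
      have h2 : ((M.map (Int.cast : ℤ → ℝ))ᵀ * Ψ * M.map (Int.cast : ℤ → ℝ)) j k =
          ∑ p, M p j * ∑ q, M q k * Ψ p q := by
        simp only [Matrix.mul_apply, Matrix.transpose_apply, Matrix.map_apply, Finset.sum_mul,
          Finset.mul_sum]
        rw [Finset.sum_comm]
        exact Finset.sum_congr rfl fun p _ => Finset.sum_congr rfl fun q _ => by ring
      rw [Matrix.sub_apply, h2, Matrix.map_apply, sub_eq_iff_eq_add] at h1
      rw [h1, e_add, e_int, one_mul]
    have h3 := r.rel.monomial_mul (fun i => M i j) (fun i => M i k)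
    rw [key]
    generalize monomial r.u (fun i => M i j) = a at *
    generalize monomial r.u (fun i => M i k) = b at *
    have hc : ∀ (w : Circle) (v : unitary r.B), Commute v (scalarUnitary r.B w) :=
      fun w v => (scalarUnitary_comm w v).symm
    rw [(hc (z j) b).mul_mul_mul_comm, (hc (z k) a).mul_mul_mul_comm, h3,
      (hc (z k) (scalarUnitary r.B (z j))).eq, ← mul_assoc _ (scalarUnitary r.B (e _)),
      ← mul_assoc (scalarUnitary r.B (e _)), (scalarUnitary_comm (e _) _)]

/-- Precomposition with `TorusModel.pullback`, on the products of all models. -/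
def pullbackProd {m n : ℕ} {Θ : Matrix (Fin m) (Fin m) ℝ} {Ψ : Matrix (Fin n) (Fin n) ℝ}
    {M : Matrix (Fin n) (Fin m) ℤ} (z : Fin m → Circle) (h : ToricCongruence Θ Ψ M) :
    lp (fun r : TorusModel Θ => r.B) ∞ →⋆ₐ[ℂ] lp (fun r : TorusModel Ψ => r.B) ∞ where
  toFun f := ⟨fun r => f (r.pullback z h), memℓp_infty ⟨‖f‖, by
    rintro _ ⟨r, rfl⟩
    exact lp.norm_apply_le_norm ENNReal.top_ne_zero f (r.pullback z h)⟩⟩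
  map_one' := rfl
  map_mul' _ _ := rfl
  map_zero' := rfl
  map_add' _ _ := rfl
  commutes' _ := rfl
  map_star' _ := rfl

lemma NCTorus.coe_monomial {m : ℕ} (Θ : Matrix (Fin m) (Fin m) ℝ) (x : Fin m → ℤ) :
    (((monomial (NCTorus.U Θ) x : unitary (NCTorus Θ)) : NCTorus Θ) :
      lp (fun r : TorusModel Θ => r.B) ∞) = (monomial (tautologicalUnitary Θ) x :
        unitary (lp (fun r : TorusModel Θ => r.B) ∞)) :=
  congrArg Subtype.val (map_monomial (unitaryMap (NCTorus Θ).subtype) (NCTorus.U Θ) x)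

lemma pullbackProd_tautological {m n : ℕ} {Θ : Matrix (Fin m) (Fin m) ℝ}
    {Ψ : Matrix (Fin n) (Fin n) ℝ} {M : Matrix (Fin n) (Fin m) ℤ} (z : Fin m → Circle)
    (h : ToricCongruence Θ Ψ M) (j : Fin m) :
    pullbackProd z h (tautologicalUnitary Θ j : lp (fun r : TorusModel Θ => r.B) ∞) =
      (z j : ℂ) • (monomial (tautologicalUnitary Ψ) (fun i => M i j) :
        unitary (lp (fun r : TorusModel Ψ => r.B) ∞)) := by
  ext r
  have h1 := congrArg Subtype.val
    (map_monomial (unitaryMap (evalProd r)) (tautologicalUnitary Ψ) (fun i => M i j))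
  have h2 : pullbackProd z h (tautologicalUnitary Θ j : lp (fun r : TorusModel Θ => r.B) ∞) r =
      (z j : ℂ) • ((monomial r.u (fun i => M i j) : unitary r.B) : r.B) :=
    (Algebra.smul_def _ _).symm
  exact h2.trans (congrArg (fun w => (z j : ℂ) • w) h1.symm)

lemma pullbackProd_mem {m n : ℕ} {Θ : Matrix (Fin m) (Fin m) ℝ} {Ψ : Matrix (Fin n) (Fin n) ℝ}
    {M : Matrix (Fin n) (Fin m) ℤ} (z : Fin m → Circle) (h : ToricCongruence Θ Ψ M)
    (a : NCTorus Θ) : pullbackProd z h a ∈ NCTorus Ψ := by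
  have hle : NCTorus Θ ≤ (NCTorus Ψ).comap (pullbackProd z h) := by
    refine StarSubalgebra.topologicalClosure_minimal ?_ ?_
    · rw [StarAlgebra.adjoin_le_iff]
      rintro _ ⟨j, rfl⟩
      change pullbackProd z h _ ∈ NCTorus Ψ
      rw [pullbackProd_tautological, ← NCTorus.coe_monomial]
      exact ((z j : ℂ) • (monomial (NCTorus.U Ψ) (fun i => M i j) :
        unitary (NCTorus Ψ)).1 : NCTorus Ψ).2
    · have hc : Continuous (pullbackProd z h) :=
        AddMonoidHomClass.continuous_of_bound (pullbackProd z h) 1 fun a => by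
          rw [one_mul]
          exact NonUnitalStarAlgHom.norm_apply_le (pullbackProd z h) a
      exact (inferInstance : IsClosed (NCTorus Ψ : Set _)).preimage hc
  exact hle a.2

/-- The toric homomorphism `φ_{M,z} : A_Θ → A_Ψ`, with `φ_{M,z}(U_j) = z_j V^{M e_j}`. -/
def toricHom {m n : ℕ} {Θ : Matrix (Fin m) (Fin m) ℝ} {Ψ : Matrix (Fin n) (Fin n) ℝ}
    {M : Matrix (Fin n) (Fin m) ℤ} (z : Fin m → Circle) (h : ToricCongruence Θ Ψ M) :
    NCTorus Θ →⋆ₐ[ℂ] NCTorus Ψ :=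
  StarAlgHom.codRestrict ((pullbackProd z h).comp (NCTorus Θ).subtype) (NCTorus Ψ)
    (pullbackProd_mem z h)

lemma toricHom_U {m n : ℕ} {Θ : Matrix (Fin m) (Fin m) ℝ} {Ψ : Matrix (Fin n) (Fin n) ℝ}
    {M : Matrix (Fin n) (Fin m) ℤ} (z : Fin m → Circle) (h : ToricCongruence Θ Ψ M) (j : Fin m) :
    toricHom z h (NCTorus.U Θ j : NCTorus Θ) =
      (z j : ℂ) • ((monomial (NCTorus.U Ψ) (fun i => M i j) : unitary (NCTorus Ψ)) :
        NCTorus Ψ) := by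
  ext1
  refine (pullbackProd_tautological z h j).trans ?_
  rw [← NCTorus.coe_monomial]
  rfl

/-! ### The left regular representation on `ℓ²(ℤᵐ) ⊗ S` and Fourier multipliers -/

/-- The Hilbert space `ℓ²(G) ⊗ S`, realized as the Hilbert sum of copies of `S` over `G`. -/
abbrev L2 (G S : Type) [NormedAddCommGroup S] : Type := lp (fun _ : G => S) 2

open Classical in
/-- The vector `δ_g ⊗ ξ`. -/
def delta {G S : Type} [NormedAddCommGroup S] (g : G) (ξ : S) : L2 G S := lp.single 2 g ξ

/-- The exponent `∑_{j<k} Θ_{j,k} x_k y_j` of the ordered-monomial cocycle. -/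
def cocycleExponent {m : ℕ} (Θ : Matrix (Fin m) (Fin m) ℝ) (x y : Fin m → ℤ) : ℝ :=
  ∑ j, ∑ k, if j < k then Θ j k * x k * y j else 0

/-- The cocycle `exp(2π i ∑_{j<k} Θ_{j,k} x_k y_j)`, for which `U^x U^y = cocycle x y U^{x+y}`. -/
def cocycle {m : ℕ} (Θ : Matrix (Fin m) (Fin m) ℝ) (x y : Fin m → ℤ) : Circle :=
  e (cocycleExponent Θ x y)

lemma cocycle_add_right {m : ℕ} (Θ : Matrix (Fin m) (Fin m) ℝ) (x y y' : Fin m → ℤ) :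
    cocycle Θ x (y + y') = cocycle Θ x y * cocycle Θ x y' := by
  rw [cocycle, cocycle, cocycle, ← e_add]
  congr 1
  simp only [cocycleExponent, ← Finset.sum_add_distrib]
  refine Finset.sum_congr rfl fun j _ => Finset.sum_congr rfl fun k _ => ?_
  split_ifs
  · push_cast [Pi.add_apply]; ring
  · simp

lemma memℓp_shift {G S : Type} [AddCommGroup G] [NormedAddCommGroup S] [InnerProductSpace ℂ S]
    (p : G → Circle) (a : G) (f : L2 G S) :
    Memℓp (fun y => (p y : ℂ) • f (y - a)) 2 := by
  have hf := (memℓp_gen_iff (by norm_num : 0 < (2 : ℝ≥0∞).toReal)).1 (lp.memℓp f)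
  refine (memℓp_gen_iff (by norm_num)).2 ?_
  simpa [norm_smul, Circle.norm_coe, Function.comp_def] using
    (Equiv.summable_iff (Equiv.subRight a)).2 hf

/-- The operator `(f_y)_y ↦ (p_y f_{y - a})_y` on `ℓ²(G) ⊗ S`. -/
def phasedShift {G S : Type} [AddCommGroup G] [NormedAddCommGroup S] [InnerProductSpace ℂ S]
    (p : G → Circle) (a : G) : L2 G S →ₗᵢ[ℂ] L2 G S where
  toFun f := ⟨fun y => (p y : ℂ) • f (y - a), memℓp_shift p a f⟩
  map_add' f g := by ext y; exact smul_add _ _ _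
  map_smul' c f := by ext y; exact smul_comm _ _ _
  norm_map' f := by
    have h2 : 0 < (2 : ℝ≥0∞).toReal := by norm_num
    rw [lp.norm_eq_tsum_rpow h2, lp.norm_eq_tsum_rpow h2]
    congr 1
    rw [← Equiv.tsum_eq (Equiv.subRight a) (fun y => ‖f y‖ ^ (2 : ℝ≥0∞).toReal)]
    simp [norm_smul, Circle.norm_coe]

/-- The twisted shift `δ_x ⊗ ξ ↦ cocycle a x δ_{a+x} ⊗ ξ`. -/
def twistedShift {m : ℕ} (Θ : Matrix (Fin m) (Fin m) ℝ) (S : Type) [NormedAddCommGroup S]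
    [InnerProductSpace ℂ S] (a : Fin m → ℤ) :
    L2 (Fin m → ℤ) S ≃ₗᵢ[ℂ] L2 (Fin m → ℤ) S :=
  LinearIsometryEquiv.ofSurjective (phasedShift (fun y => cocycle Θ a (y - a)) a) fun g =>
    ⟨phasedShift (fun y => (cocycle Θ a y)⁻¹) (-a) g, by
      ext y
      change (cocycle Θ a (y - a) : ℂ) • ((cocycle Θ a (y - a))⁻¹ : Circle).1 • g (y - a - -a) = g y
      rw [smul_smul, Circle.coe_inv, mul_inv_cancel₀ (Circle.coe_ne_zero _), one_smul]
      simp⟩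

lemma twistedShift_apply {m : ℕ} (Θ : Matrix (Fin m) (Fin m) ℝ) (S : Type) [NormedAddCommGroup S]
    [InnerProductSpace ℂ S] (a : Fin m → ℤ) (f : L2 (Fin m → ℤ) S) (y : Fin m → ℤ) :
    twistedShift Θ S a f y = (cocycle Θ a (y - a) : ℂ) • f (y - a) := rfl

lemma twistedShift_delta {m : ℕ} (Θ : Matrix (Fin m) (Fin m) ℝ) (S : Type) [NormedAddCommGroup S]
    [InnerProductSpace ℂ S] (a x : Fin m → ℤ) (ξ : S) :
    twistedShift Θ S a (delta x ξ) = (cocycle Θ a x : ℂ) • delta (a + x) ξ := by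
  ext y
  rw [twistedShift_apply, lp.coeFn_smul, Pi.smul_apply]
  by_cases h : y = a + x
  · subst h; simp [delta]
  · have h' : y - a ≠ x := fun h' => h (by rw [← h']; abel)
    simp [delta, h, h']

lemma cocycle_single {m : ℕ} {Θ : Matrix (Fin m) (Fin m) ℝ} (hΘ : Θᵀ = -Θ) (j k : Fin m) :
    cocycle Θ (Pi.single k 1) (Pi.single j 1) =
      e (Θ j k) * cocycle Θ (Pi.single j 1) (Pi.single k 1) := by
  have hB : ∀ j k : Fin m, cocycleExponent Θ (Pi.single k 1) (Pi.single j 1) =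
      if j < k then Θ j k else 0 := by
    intro j k
    rw [cocycleExponent, Finset.sum_eq_single j, Finset.sum_eq_single k]
    · simp
    · intro k' _ h; simp [h]
    · simp
    · intro j' _ h; simp [h]
    · simp
  have hs : Θ k j = - Θ j k := by
    have := congrFun (congrFun hΘ j) k
    simpa using this
  rw [cocycle, cocycle, ← e_add, hB, hB]
  congr 1
  rcases lt_trichotomy j k with h | h | h
  · simp [h, h.le.not_gt]
  · subst h
    have : Θ j j = 0 := by linarith
    simp [this]
  · simp [h, h.le.not_gt, hs]

/-- The twisted shifts on `ℓ²(ℤᵐ) ⊗ S` as a model of `A_Θ`. -/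
def regularModel {m : ℕ} {Θ : Matrix (Fin m) (Fin m) ℝ} (hΘ : Θᵀ = -Θ) (S : Type)
    [NormedAddCommGroup S] [InnerProductSpace ℂ S] [CompleteSpace S] [Nontrivial S] :
    TorusModel Θ where
  B := L2 (Fin m → ℤ) S →L[ℂ] L2 (Fin m → ℤ) S
  nontrivial := by
    obtain ⟨ξ, hξ⟩ := exists_ne (0 : S)
    have : Nontrivial (L2 (Fin m → ℤ) S) := by
      refine ⟨delta 0 ξ, 0, fun h => hξ ?_⟩
      have := congrArg (fun f : L2 (Fin m → ℤ) S => f 0) h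
      simpa [delta] using this
    infer_instance
  u j := Unitary.linearIsometryEquiv.symm (twistedShift Θ S (Pi.single j 1))
  rel := by
    intro j k
    ext f : 1
    ext y
    change twistedShift Θ S (Pi.single k 1) (twistedShift Θ S (Pi.single j 1) f) y =
      (e (Θ j k) : ℂ) • twistedShift Θ S (Pi.single j 1) (twistedShift Θ S (Pi.single k 1) f) y
    simp only [twistedShift_apply, smul_smul, ← Circle.coe_mul]
    have hy : y - Pi.single j 1 - Pi.single k 1 = y - Pi.single k 1 - Pi.single j 1 :=
      sub_right_comm _ _ _
    have h1 : y - Pi.single k 1 = (y - Pi.single k 1 - Pi.single j 1) + Pi.single j 1 := by abel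
    have h2 : y - Pi.single j 1 = (y - Pi.single k 1 - Pi.single j 1) + Pi.single k 1 := by abel
    rw [hy, h2, show cocycle Θ (Pi.single k 1) (y - Pi.single k 1) = _ from
      (congrArg _ h1).trans (cocycle_add_right _ _ _ _), cocycle_add_right, cocycle_single hΘ]
    congr 2
    simp only [mul_comm, mul_left_comm, mul_assoc]
    rfl

/-- The left regular representation `π_Θ` of `A_Θ` on `L²(A_Θ, τ_Θ) ⊗ S = ℓ²(ℤᵐ) ⊗ S`, with
`π_Θ(U^a) (δ_x ⊗ ξ) = cocycle a x δ_{a+x} ⊗ ξ`. Here `δ_x` is the GNS vector of the ordered monomial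
`U^x`; the cyclic vector is `δ_0`, and `a ↦ ⟨δ_0, a δ_0⟩` is the canonical trace `τ_Θ`. -/
def regularRep {m : ℕ} {Θ : Matrix (Fin m) (Fin m) ℝ} (hΘ : Θᵀ = -Θ) (S : Type)
    [NormedAddCommGroup S] [InnerProductSpace ℂ S] [CompleteSpace S] [Nontrivial S] :
    NCTorus Θ →⋆ₐ[ℂ] (L2 (Fin m → ℤ) S →L[ℂ] L2 (Fin m → ℤ) S) :=
  NCTorus.lift (regularModel hΘ S)

lemma regularRep_U {m : ℕ} {Θ : Matrix (Fin m) (Fin m) ℝ} (hΘ : Θᵀ = -Θ) (S : Type)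
    [NormedAddCommGroup S] [InnerProductSpace ℂ S] [CompleteSpace S] [Nontrivial S] (j : Fin m)
    (x : Fin m → ℤ) (ξ : S) :
    regularRep hΘ S (NCTorus.U Θ j : NCTorus Θ) (delta x ξ) =
      (cocycle Θ (Pi.single j 1) x : ℂ) • delta (Pi.single j 1 + x) ξ :=
  twistedShift_delta Θ S (Pi.single j 1) x ξ

/-- The diagonal operator `δ_g ⊗ ξ ↦ δ_g ⊗ F(g) ξ` on its maximal domain
`{(ξ_g) : ∑ ‖F(g) ξ_g‖² < ∞}`. -/
def multiplier {G S : Type} [NormedAddCommGroup S] [InnerProductSpace ℂ S] [CompleteSpace S]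
    (F : G → selfAdjoint (S →L[ℂ] S)) : L2 G S →ₗ.[ℂ] L2 G S where
  domain :=
    { carrier := {f | Memℓp (fun g => (F g : S →L[ℂ] S) (f g)) 2}
      zero_mem' := by
        simpa [Pi.zero_def] using (zero_memℓp : Memℓp (0 : G → S) 2)
      add_mem' := by
        intro f g hf hg
        simpa [Pi.add_def] using Memℓp.add hf hg
      smul_mem' := by
        intro c f hf
        simpa [Pi.smul_def] using Memℓp.const_smul hf c }
  toFun :=
    { toFun f := ⟨fun g => (F g : S →L[ℂ] S) (f.1 g), f.2⟩
      map_add' f g := by ext x; exact map_add (F x : S →L[ℂ] S) _ _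
      map_smul' c f := by ext x; exact map_smul (F x : S →L[ℂ] S) _ _ }

/-- For every `R > 0`, the direct sum of one copy of `S` for each `g` with
`Spec F(g) ∩ [-R, R] ≠ ∅` is finite-dimensional. -/
def FiniteSpectralMultiplicity {G S : Type} [NormedAddCommGroup S] [InnerProductSpace ℂ S]
    [CompleteSpace S] (F : G → selfAdjoint (S →L[ℂ] S)) : Prop :=
  ∀ R : ℝ, 0 < R → FiniteDimensional ℂ (DirectSum
    {g : G // ∃ t ∈ Set.Icc (-R) R, (t : ℂ) ∈ spectrum ℂ (F g : S →L[ℂ] S)} fun _ => S)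

/-- For every `h`, `sup_g ‖F(g + h) - F(g)‖ < ∞`. -/
def BoundedTranslationIncrements {G S : Type} [Add G] [NormedAddCommGroup S]
    [InnerProductSpace ℂ S] [CompleteSpace S] (F : G → selfAdjoint (S →L[ℂ] S)) : Prop :=
  ∀ h : G, BddAbove (Set.range fun g => ‖(F (g + h) : S →L[ℂ] S) - (F g : S →L[ℂ] S)‖)

/-! ### Spectral triples -/

/-- `R` is the resolvent `(D - z)⁻¹` of the unbounded operator `D`. -/
def IsResolvent {H : Type*} [NormedAddCommGroup H] [InnerProductSpace ℂ H] (D : H →ₗ.[ℂ] H)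
    (z : ℂ) (R : H →L[ℂ] H) : Prop :=
  (∀ ξ : D.domain, R (D ξ - z • (ξ : H)) = ξ) ∧
    ∀ η : H, ∃ ξ : D.domain, (ξ : H) = R η ∧ D ξ - z • (ξ : H) = η

/-- The resolvent set of `D` is nonempty and all resolvents of `D` are compact. -/
def HasCompactResolvent {H : Type*} [NormedAddCommGroup H] [InnerProductSpace ℂ H]
    (D : H →ₗ.[ℂ] H) : Prop :=
  (∃ z R, IsResolvent D z R) ∧ ∀ z R, IsResolvent D z R → IsCompactOperator R

/-- The elements `a` for which the commutator `[D, π(a)]`, with domain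
`{ξ ∈ Dom D : π(a) ξ ∈ Dom D}`, is densely defined and extends to a bounded operator. -/
def boundedCommutators {A H : Type*} [CStarAlgebra A] [NormedAddCommGroup H]
    [InnerProductSpace ℂ H] [CompleteSpace H] (π : A →⋆ₐ[ℂ] (H →L[ℂ] H)) (D : H →ₗ.[ℂ] H) :
    Set A :=
  {a | Dense {ξ : H | ξ ∈ D.domain ∧ π a ξ ∈ D.domain} ∧
    ∃ C : H →L[ℂ] H, ∀ (ξ : H) (hξ : ξ ∈ D.domain) (hξ' : π a ξ ∈ D.domain),
      C ξ = D ⟨π a ξ, hξ'⟩ - π a (D ⟨ξ, hξ⟩)}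

/-- `(A, H, D)`, with `A` represented on `H` by `π`, is a spectral triple. -/
structure IsSpectralTriple {A H : Type*} [CStarAlgebra A] [NormedAddCommGroup H]
    [InnerProductSpace ℂ H] [CompleteSpace H] (π : A →⋆ₐ[ℂ] (H →L[ℂ] H)) (D : H →ₗ.[ℂ] H) :
    Prop where
  faithful : Function.Injective π
  dense_domain : Dense (D.domain : Set H)
  selfAdjoint : IsSelfAdjoint D
  compactResolvent : HasCompactResolvent D
  dense_boundedCommutators : Dense (boundedCommutators π D)

/-! ### Inductive limits of Hilbert spaces and of unbounded operators -/

section HilbertLimit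

variable {H : ℕ → Type} [∀ n, NormedAddCommGroup (H n)] [∀ n, InnerProductSpace ℂ (H n)]

/-- The isometry `I_{k-1} ∘ ⋯ ∘ I_n : H_n → H_k`. -/
def isometryTransition (I : ∀ n, H n →ₗᵢ[ℂ] H (n + 1)) (n k : ℕ) (h : n ≤ k) :
    H n →ₗᵢ[ℂ] H k :=
  Nat.leRec (motive := fun k _ => H n →ₗᵢ[ℂ] H k) LinearIsometry.id
    (fun k _ f => (I k).comp f) h

lemma isometryTransition_succ (I : ∀ n, H n →ₗᵢ[ℂ] H (n + 1)) (n k : ℕ) (h : n ≤ k)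
    (h' : n ≤ k + 1) :
    isometryTransition I n (k + 1) h' = (I k).comp (isometryTransition I n k h) :=
  Nat.leRec_succ _ _ h

instance isometryTransition_directedSystem (I : ∀ n, H n →ₗᵢ[ℂ] H (n + 1)) :
    DirectedSystem H (isometryTransition I · · ·) where
  map_self n x := by simp [isometryTransition]
  map_map k j i hij hjk x := by
    induction hjk with
    | refl => simp [isometryTransition]
    | @step k hjk ih =>
      have h1 := isometryTransition_succ I j k hjk (Nat.le_succ_of_le hjk)
      have h2 := isometryTransition_succ I i k (hij.trans hjk) (hij.trans (Nat.le_succ_of_le hjk))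
      exact (DFunLike.congr_fun h1 _).trans
        ((congrArg (I k) ih).trans (DFunLike.congr_fun h2 x).symm)

/-- The algebraic direct limit of a sequence of Hilbert spaces and isometries. -/
def PreHilbertLimit (I : ∀ n, H n →ₗᵢ[ℂ] H (n + 1)) : Type :=
  DirectLimit H (isometryTransition I)

variable (I : ∀ n, H n →ₗᵢ[ℂ] H (n + 1))

instance : AddCommGroup (PreHilbertLimit I) :=
  inferInstanceAs (AddCommGroup (DirectLimit H (isometryTransition I)))

instance : Module ℂ (PreHilbertLimit I) :=
  inferInstanceAs (Module ℂ (DirectLimit H (isometryTransition I)))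

/-- The map from a stage into the algebraic direct limit. -/
def toPreHilbertLimit (n : ℕ) : H n →ₗ[ℂ] PreHilbertLimit I where
  toFun x := (⟦⟨n, x⟩⟧ : DirectLimit H (isometryTransition I))
  map_add' x y := (DirectLimit.add_def n x y).symm
  map_smul' c x := (DirectLimit.smul_def n x c).symm

/-- The inner product on the algebraic direct limit, computed at any common stage. -/
@[reducible]
def preHilbertLimitCore : InnerProductSpace.Core ℂ (PreHilbertLimit I) where
  inner x y := DirectLimit.lift₂ (isometryTransition I) (isometryTransition I)
    (fun _ x y => inner ℂ x y)
    (fun i j h x y => ((isometryTransition I i j h).inner_map_map x y).symm) x y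
  conj_inner_symm := DirectLimit.induction₂ _ fun i x y => by
    rw [DirectLimit.lift₂_def, DirectLimit.lift₂_def, inner_conj_symm]
  re_inner_nonneg := DirectLimit.induction _ fun i x => by
    rw [DirectLimit.lift₂_def]
    exact inner_self_nonneg
  add_left := DirectLimit.induction₃ _ fun i x y z => by
    erw [DirectLimit.add_def, DirectLimit.lift₂_def, DirectLimit.lift₂_def, DirectLimit.lift₂_def,
      inner_add_left]
  smul_left := fun x y r => DirectLimit.induction₂ _ (fun i x y => by
    erw [DirectLimit.smul_def, DirectLimit.lift₂_def, DirectLimit.lift₂_def, inner_smul_left]) x y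
  definite := DirectLimit.induction _ fun i x h => by
    rw [DirectLimit.lift₂_def, inner_self_eq_zero] at h
    rw [h]
    exact (DirectLimit.zero_def i).symm

instance : NormedAddCommGroup (PreHilbertLimit I) :=
  (preHilbertLimitCore I).toNormedAddCommGroup

instance : InnerProductSpace ℂ (PreHilbertLimit I) :=
  InnerProductSpace.ofCore (preHilbertLimitCore I).toCore

lemma inner_toPreHilbertLimit (n : ℕ) (x y : H n) :
    inner ℂ (toPreHilbertLimit I n x) (toPreHilbertLimit I n y) = inner ℂ x y :=
  DirectLimit.lift₂_def (isometryTransition I) (isometryTransition I)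
    (fun _ x y => inner ℂ x y)
    (fun i j h x y => ((isometryTransition I i j h).inner_map_map x y).symm) n x y

lemma norm_toPreHilbertLimit (n : ℕ) (x : H n) : ‖toPreHilbertLimit I n x‖ = ‖x‖ := by
  rw [norm_eq_sqrt_re_inner (𝕜 := ℂ), inner_toPreHilbertLimit, ← norm_eq_sqrt_re_inner]

/-- The Hilbert space inductive limit. -/
abbrev HilbertLimit : Type := UniformSpace.Completion (PreHilbertLimit I)

/-- The canonical isometries into the Hilbert space inductive limit. -/
def toHilbertLimit (n : ℕ) : H n →ₗᵢ[ℂ] HilbertLimit I :=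
  UniformSpace.Completion.toComplₗᵢ.comp
    { toPreHilbertLimit I n with norm_map' := norm_toPreHilbertLimit I n }

/-- The union of the graphs of the operators `j_n D_n j_n⁻¹`, that is, the graph of
`j_n ξ ↦ j_n (D_n ξ)` for `ξ ∈ Dom D_n`. -/
def limitGraph (D : ∀ n, H n →ₗ.[ℂ] H n) : Submodule ℂ (HilbertLimit I × HilbertLimit I) :=
  ⨆ n, (D n).graph.map
    ((toHilbertLimit I n).toLinearMap.prodMap (toHilbertLimit I n).toLinearMap)

/-- The operator `j_n ξ ↦ j_n (D_n ξ)` on the core `⋃_n j_n (Dom D_n)`. -/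
def limitCoreOperator (D : ∀ n, H n →ₗ.[ℂ] H n) : HilbertLimit I →ₗ.[ℂ] HilbertLimit I :=
  (limitGraph I D).toLinearPMap

/-- The inductive limit of the operators `D_n`: the closure of `limitCoreOperator`. -/
def limitOperator (D : ∀ n, H n →ₗ.[ℂ] H n) : HilbertLimit I →ₗ.[ℂ] HilbertLimit I :=
  (limitCoreOperator I D).closure

/-- The construction of `limitOperator` is legitimate: the prescription `j_n ξ ↦ j_n (D_n ξ)` is
single-valued, densely defined and closable. -/
def LimitOperatorWellDefined (D : ∀ n, H n →ₗ.[ℂ] H n) : Prop :=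
  (limitCoreOperator I D).graph = limitGraph I D ∧
    Dense ((limitCoreOperator I D).domain : Set (HilbertLimit I)) ∧
    (limitCoreOperator I D).IsClosable

end HilbertLimit

/-! ### Inductive limits of C⋆-algebras -/

section CStarLimit

variable {A : ℕ → Type*} [∀ n, CStarAlgebra (A n)]

/-- A nonzero unital C⋆-algebra with compatible unital ⋆-homomorphisms from the `A_n`. -/
structure CStarCocone (φ : ∀ n, A n →⋆ₐ[ℂ] A (n + 1)) where
  B : Type
  [cstar : CStarAlgebra B]
  [nontrivial : Nontrivial B]
  ψ : ∀ n, A n →⋆ₐ[ℂ] B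
  compat : ∀ n a, ψ (n + 1) (φ n a) = ψ n a

attribute [instance] CStarCocone.cstar CStarCocone.nontrivial

variable (φ : ∀ n, A n →⋆ₐ[ℂ] A (n + 1))

/-- All the maps from `A_n` into cocones, as one map into the product of all cocones. -/
def toCoconeProd (n : ℕ) : A n →⋆ₐ[ℂ] lp (fun c : CStarCocone φ => c.B) ∞ where
  toFun a := ⟨fun c => c.ψ n a, memℓp_infty ⟨‖a‖, by
    rintro _ ⟨c, rfl⟩
    exact NonUnitalStarAlgHom.norm_apply_le (c.ψ n) a⟩⟩
  map_one' := by ext c; exact map_one _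
  map_mul' a b := by ext c; exact map_mul _ _ _
  map_zero' := by ext c; exact map_zero _
  map_add' a b := by ext c; exact map_add _ _ _
  commutes' r := by ext c; exact AlgHomClass.commutes (c.ψ n) r
  map_star' a := by ext c; exact map_star _ _

/-- The inductive limit `lim (A_n, φ_n)` of a sequence of unital C⋆-algebras, as the closure of the
union of the images of the `A_n` in the product of all cocones; it is the universal cocone.
(Cocones in `Type` suffice when the `A_n` are separable, as the noncommutative tori are: a
separable C⋆-algebra is isomorphic to one in `Type`.) -/
def CStarLimit : StarSubalgebra ℂ (lp (fun c : CStarCocone φ => c.B) ∞) :=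
  (⨆ n, (toCoconeProd φ n).range).topologicalClosure

instance : IsClosed (CStarLimit φ : Set (lp (fun c : CStarCocone φ => c.B) ∞)) :=
  StarSubalgebra.isClosed_topologicalClosure _

/-- The canonical maps into the inductive limit. -/
def toCStarLimit (n : ℕ) : A n →⋆ₐ[ℂ] CStarLimit φ :=
  StarAlgHom.codRestrict (toCoconeProd φ n) (CStarLimit φ) fun a =>
    StarSubalgebra.le_topologicalClosure _
      (le_iSup (fun n => (toCoconeProd φ n).range) n ⟨a, rfl⟩)

lemma toCStarLimit_comp (n : ℕ) (a : A n) :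
    toCStarLimit φ (n + 1) (φ n a) = toCStarLimit φ n a := by
  ext c
  exact c.compat n a

end CStarLimit

/-! ### Unital toric inductive systems -/

/-- `Θ` is nondegenerate: only `x = 0` satisfies `exp(2π i ⟨x, Θ y⟩) = 1` for all `y ∈ ℤᵐ`. -/
def Nondegenerate {m : ℕ} (Θ : Matrix (Fin m) (Fin m) ℝ) : Prop :=
  ∀ x : Fin m → ℤ,
    (∀ y : Fin m → ℤ, e ((fun j => (x j : ℝ)) ⬝ᵥ (Θ *ᵥ fun k => (y k : ℝ))) = 1) → x = 0

/-- The data of a unital toric inductive system of simple noncommutative tori. -/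
structure ToricSystem where
  m : ℕ → ℕ
  Θ : ∀ n, Matrix (Fin (m n)) (Fin (m n)) ℝ
  skew : ∀ n, (Θ n)ᵀ = -Θ n
  nondegenerate : ∀ n, Nondegenerate (Θ n)
  M : ∀ n, Matrix (Fin (m (n + 1))) (Fin (m n)) ℤ
  z : ∀ n, Fin (m n) → Circle
  congruence : ∀ n, ToricCongruence (Θ n) (Θ (n + 1)) (M n)

namespace ToricSystem

variable (T : ToricSystem)

/-- The lattice `ℤ^{m_n}` of Fourier labels. -/
abbrev Label (n : ℕ) : Type := Fin (T.m n) → ℤ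

/-- The noncommutative torus `A_n = A_{Θ_n}`. -/
abbrev A (n : ℕ) : Type 1 := NCTorus (T.Θ n)

/-- The connecting map `φ_n = φ_{M_n, z_n} : A_n → A_{n+1}`. -/
def φ (n : ℕ) : T.A n →⋆ₐ[ℂ] T.A (n + 1) := toricHom (T.z n) (T.congruence n)

/-- The matrix product `M_{k-1} ⋯ M_n` as a map `ℤ^{m_n} → ℤ^{m_k}`. -/
def labelTransition (n k : ℕ) (h : n ≤ k) : T.Label n →ₗ[ℤ] T.Label k :=
  Nat.leRec (motive := fun k _ => T.Label n →ₗ[ℤ] T.Label k) LinearMap.id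
    (fun k _ f => (T.M k).mulVecLin ∘ₗ f) h

lemma labelTransition_succ (n k : ℕ) (h : n ≤ k) (h' : n ≤ k + 1) :
    T.labelTransition n (k + 1) h' = (T.M k).mulVecLin ∘ₗ T.labelTransition n k h :=
  Nat.leRec_succ _ _ h

instance labelTransition_directedSystem : DirectedSystem T.Label (T.labelTransition · · ·) where
  map_self n x := by simp [labelTransition]
  map_map k j i hij hjk x := by
    induction hjk with
    | refl => simp [labelTransition]
    | @step k hjk ih =>
      have h1 := T.labelTransition_succ j k hjk (Nat.le_succ_of_le hjk)
      have h2 := T.labelTransition_succ i k (hij.trans hjk) (hij.trans (Nat.le_succ_of_le hjk))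
      exact (DFunLike.congr_fun h1 _).trans
        ((congrArg (T.M k).mulVecLin ih).trans (DFunLike.congr_fun h2 x).symm)

/-- The label group `G_∞ = lim (ℤ^{m_n}, M_n)`. -/
abbrev G : Type := DirectLimit T.Label T.labelTransition

/-- The class `[x, n] ∈ G_∞` of `x ∈ ℤ^{m_n}`. -/
def label (n : ℕ) (x : T.Label n) : T.G := ⟦⟨n, x⟩⟧

variable (S : Type) [NormedAddCommGroup S] [InnerProductSpace ℂ S] [CompleteSpace S] [Nontrivial S]

/-- The Hilbert space `H_n = L²(A_n, τ_n) ⊗ S = ℓ²(ℤ^{m_n}) ⊗ S`. -/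
abbrev H (S : Type) [NormedAddCommGroup S] (n : ℕ) : Type := L2 (T.Label n) S

/-- The representation `π_n` of `A_n` on `H_n`. -/
def π (n : ℕ) : T.A n →⋆ₐ[ℂ] (T.H S n →L[ℂ] T.H S n) := regularRep (T.skew n) S

variable {S}

/-- The vector `Λ_n(a) ⊗ ξ ∈ H_n`, where `Λ_n(a) = π_n(a) δ_0` is the GNS vector of `a`. -/
def Λ (n : ℕ) (a : T.A n) (ξ : S) : T.H S n := T.π S n a (delta 0 ξ)

/-- The isometries `I_n : H_n → H_{n+1}` are those induced by the connecting maps,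
`I_n (Λ_n(a) ⊗ ξ) = Λ_{n+1}(φ_n(a)) ⊗ ξ`. -/
def IsGNSIsometry (I : ∀ n, T.H S n →ₗᵢ[ℂ] T.H S (n + 1)) : Prop :=
  ∀ n (a : T.A n) (ξ : S), I n (T.Λ n a ξ) = T.Λ (n + 1) (T.φ n a) ξ

/-- The protoral C⋆-algebra `A_pro = lim (A_n, φ_n)`. -/
abbrev Apro : Type 1 := CStarLimit T.φ

/-- The representation `π` of `A_pro = lim A_n` on `H_pro = lim H_n` is the one induced by the
representations `π_n`, that is, `π(ι_n(a)) j_n = j_n π_n(a)`. -/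
def IsLimitRep (I : ∀ n, T.H S n →ₗᵢ[ℂ] T.H S (n + 1))
    (π : T.Apro →⋆ₐ[ℂ] (HilbertLimit I →L[ℂ] HilbertLimit I)) : Prop :=
  ∀ n (a : T.A n) (η : T.H S n),
    π (toCStarLimit T.φ n a) (toHilbertLimit I n η) = toHilbertLimit I n (T.π S n a η)

end ToricSystem

end Protorus

end

/-! Everything is indexed by lattice labels, up to phases. A connecting map sends `U^x` to a phase
times `V^{Mx}`, so the GNS isometry must send `δ_x` to a phase times `δ_{Mx}`. Nondegeneracy of
`Θ_n` makes `M_n` injective (`mulVec_injective`), so distinct labels stay orthogonal, and `H_pro`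
becomes `ℓ²(G_∞) ⊗ S` once a unit vector direction is fixed for each label
(`IsGNSIsometry.exists_unitary`). The phases are never computed: modulo scalars the generators
commute, and an equality of monomials in that quotient is an equality up to a phase
(`toProjective_eq_iff`).

The graph of a multiplier is cut out by closed coordinate equations, and the finitely supported
vectors form a core. Phases commute with the blocks `F(g)`, so the graphs of the `D_n` lie in the
transported graph of `D_{F_∞}`, and together they contain its core. Hence that graph is the closure
of their union (`pulledGraph_eq_closure`), which gives single-valuedness, closability and `V D_pro
V⋆ = D_{F_∞}` at once.

The regular representation of each stage is faithful because averaging over the gauge torus yields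
the canonical vector state, and a positive continuous function with zero integral vanishes
(`injective_of_average`). Injective ⋆-homomorphisms are isometric, and a lower norm bound survives
the passage to the limit (`limitRep_injective`).

The other axioms are read off from `D_{F_∞}`. Selfadjoint blocks on the maximal domain give a
selfadjoint operator; (a) makes the resolvent a norm limit of finite truncations; by (b) a monomial,
being a phased translation, has as commutator a bounded diagonal operator followed by that
translation. Monomials span densely, so the bounded commutators are dense. -/

open scoped ENNReal Matrix

noncomputable section

namespace Protorus

open MeasureTheory

/-! ### Vectors of `ℓ²(G) ⊗ S` -/

section Delta

variable {G S : Type} [NormedAddCommGroup S]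

lemma delta_apply_self (g : G) (ξ : S) : (delta g ξ : L2 G S) g = ξ := by
  simp [delta]

lemma delta_apply_ne {g h : G} (ξ : S) (hgh : h ≠ g) : (delta g ξ : L2 G S) h = 0 := by
  simp [delta, hgh]

lemma norm_delta (g : G) (ξ : S) : ‖(delta g ξ : L2 G S)‖ = ‖ξ‖ := by
  classical
  exact lp.norm_single (E := fun _ : G => S) (p := 2) (by norm_num) g ξ

lemma hasSum_delta (f : L2 G S) : HasSum (fun g => (delta g (f g) : L2 G S)) f := by
  classical
  unfold delta
  convert lp.hasSum_single (p := 2) (by norm_num) f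

variable [InnerProductSpace ℂ S]

variable (S) in
/-- The isometric embedding of `S` as the summand of `ℓ²(G) ⊗ S` at `g`. -/
def deltaIsometry (g : G) : S →ₗᵢ[ℂ] L2 G S where
  toFun ξ := delta g ξ
  map_add' ξ η := by
    ext h
    by_cases hgh : h = g
    · subst hgh; simp [delta_apply_self]
    · simp [delta_apply_ne _ hgh]
  map_smul' c ξ := by
    ext h
    by_cases hgh : h = g
    · subst hgh; simp [delta_apply_self]
    · simp [delta_apply_ne _ hgh]
  norm_map' ξ := norm_delta g ξ

lemma inner_delta_left (g : G) (ξ : S) (f : L2 G S) : inner ℂ (delta g ξ) f = inner ℂ ξ (f g) := by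
  classical
  unfold delta
  convert lp.inner_single_left (𝕜 := ℂ) g ξ f

lemma inner_delta_of_ne {g h : G} (hgh : g ≠ h) (ξ η : S) :
    inner ℂ (delta g ξ : L2 G S) (delta h η) = 0 := by
  rw [inner_delta_left, delta_apply_ne _ hgh, inner_zero_right]

/-- A closed subspace containing all `δ_g ⊗ ξ` is everything. -/
lemma mem_of_delta_mem {K : Submodule ℂ (L2 G S)} (hK : IsClosed (K : Set (L2 G S)))
    (h : ∀ g ξ, delta g ξ ∈ K) (f : L2 G S) : f ∈ K :=
  hK.mem_of_tendsto (hasSum_delta f)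
    (Filter.Eventually.of_forall fun _ => K.sum_mem fun g _ => h g (f g))

lemma ext_delta {E : Type*} [NormedAddCommGroup E] [NormedSpace ℂ E] {T T' : L2 G S →L[ℂ] E}
    (h : ∀ g ξ, T (delta g ξ) = T' (delta g ξ)) : T = T' := by
  ext f : 1
  exact mem_of_delta_mem (K := LinearMap.eqLocus T.toLinearMap T'.toLinearMap)
    (isClosed_eq T.continuous T'.continuous) h f

end Delta

/-! ### Monomials modulo scalars -/

lemma monomial_eq_prod {m : ℕ} {C : Type*} [CommGroup C] (u : Fin m → C) (x : Fin m → ℤ) :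
    monomial u x = ∏ i, u i ^ x i := by
  simp [monomial, List.prod_ofFn]

lemma monomial_single {m : ℕ} {C : Type*} [Group C] (u : Fin m → C) (j : Fin m) :
    monomial u (Pi.single j 1) = u j := by
  have h : ∀ (l : List (Fin m)), l.Nodup →
      (l.map fun i => u i ^ (Pi.single j 1 : Fin m → ℤ) i).prod = if j ∈ l then u j else 1 := by
    intro l
    induction l with
    | nil => simp
    | cons a l ih =>
      intro hl
      rw [List.nodup_cons] at hl
      rw [List.map_cons, List.prod_cons, ih hl.2]
      by_cases haj : a = j
      · subst haj; simp [hl.1]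
      · simp [haj, Ne.symm haj]
  have := h (List.finRange m) (List.nodup_finRange m)
  simpa [monomial, List.ofFn_eq_map] using this

/-- A pairwise commuting family comes from a commutative group. -/
lemma exists_commGroup_lift.{u} {m : ℕ} {Q : Type u} [Group Q] (v : Fin m → Q)
    (hv : ∀ i j, v i * v j = v j * v i) :
    ∃ (C : Type u) (_ : CommGroup C) (f : C →* Q) (w : Fin m → C), ∀ i, f (w i) = v i := by
  have : IsMulCommutative (Subgroup.closure (Set.range v)) := by
    refine Subgroup.isMulCommutative_closure ?_
    rintro _ ⟨i, rfl⟩ _ ⟨j, rfl⟩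
    exact hv i j
  exact ⟨Subgroup.closure (Set.range v),
    { (inferInstance : Group (Subgroup.closure (Set.range v))) with mul_comm := this.1.1 },
    (Subgroup.closure (Set.range v)).subtype,
    fun i => ⟨v i, Subgroup.subset_closure ⟨i, rfl⟩⟩, fun i => rfl⟩

/-- The identity is the image of one in a commutative group, where the order of the factors is
irrelevant. It is applied to the generators of a noncommutative torus modulo scalars. -/
lemma monomial_add_of_comm {m : ℕ} {Q : Type*} [Group Q] {v : Fin m → Q}
    (hv : ∀ i j, v i * v j = v j * v i) (x y : Fin m → ℤ) :
    monomial v (x + y) = monomial v x * monomial v y := by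
  obtain ⟨C, _, f, w, hw⟩ := exists_commGroup_lift v hv
  obtain rfl : (fun i => f (w i)) = v := funext hw
  simp only [← map_monomial, ← map_mul]
  congr 1
  simp [monomial_eq_prod, zpow_add, Finset.prod_mul_distrib]

lemma monomial_neg_of_comm {m : ℕ} {Q : Type*} [Group Q] {v : Fin m → Q}
    (hv : ∀ i j, v i * v j = v j * v i) (x : Fin m → ℤ) :
    monomial v (-x) = (monomial v x)⁻¹ := by
  rw [eq_inv_iff_mul_eq_one, ← monomial_add_of_comm hv]
  simp [monomial]

lemma monomial_mulVec_of_comm {m n : ℕ} {Q : Type*} [Group Q] {v : Fin n → Q}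
    (hv : ∀ i j, v i * v j = v j * v i) (M : Matrix (Fin n) (Fin m) ℤ) (x : Fin m → ℤ) :
    monomial (fun j => monomial v fun i => M i j) x = monomial v (M *ᵥ x) := by
  obtain ⟨C, _, f, w, hw⟩ := exists_commGroup_lift v hv
  obtain rfl : (fun i => f (w i)) = v := funext hw
  simp only [← map_monomial]
  congr 1
  simp only [monomial_eq_prod, ← Finset.prod_zpow, ← zpow_mul]
  rw [Finset.prod_comm]
  refine Finset.prod_congr rfl fun i _ => ?_
  -- The power `w_i ^ k` is additive in `k`, so the product over `j` of the powers with exponents `M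
  -- i j * x j` is the power with exponent `(M x)_i`.
  exact (map_sum (zmultiplesHom (Additive C) (Additive.ofMul (w i))) _ _).symm

/-! ### Unitaries modulo scalars of modulus one. -/

section Phases

variable {B : Type*} [CStarAlgebra B]

instance scalarUnitary_range_normal : (scalarUnitary B).range.Normal where
  conj_mem := by
    rintro _ ⟨z, rfl⟩ g
    rw [← scalarUnitary_comm, mul_inv_cancel_right]
    exact ⟨z, rfl⟩

/-- The quotient of the unitary group by the scalars. -/
abbrev ProjectiveUnitary (B : Type*) [CStarAlgebra B] : Type _ :=
  unitary B ⧸ (scalarUnitary B).range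

/-- The quotient map onto the projective unitary group. -/
abbrev toProjective (B : Type*) [CStarAlgebra B] : unitary B →* ProjectiveUnitary B :=
  QuotientGroup.mk' (scalarUnitary B).range

lemma coe_scalarUnitary_mul (z : Circle) (b : unitary B) :
    ((scalarUnitary B z * b : unitary B) : B) = (z : ℂ) • (b : B) :=
  (Algebra.smul_def _ _).symm

lemma toProjective_scalar (z : Circle) : toProjective B (scalarUnitary B z) = 1 :=
  (QuotientGroup.eq_one_iff _).2 ⟨z, rfl⟩

/-- This turns the search for an unspecified phase into an equation in a group where torus
generators commute. The phases relating products, adjoints and images of monomials arise this way.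
-/
lemma toProjective_eq_iff {a b : unitary B} :
    toProjective B a = toProjective B b ↔ ∃ z : Circle, (a : B) = (z : ℂ) • (b : B) := by
  constructor
  · intro h
    obtain ⟨z, hz⟩ := QuotientGroup.eq.1 h.symm
    refine ⟨z, ?_⟩
    -- The quotient relation makes `b⁻¹ * a` the scalar; being central, it can be moved to the other
    -- side of `b`.
    rw [← coe_scalarUnitary_mul, hz, ← hz, scalarUnitary_comm, hz, mul_inv_cancel_left]
  · rintro ⟨z, hz⟩
    rw [← coe_scalarUnitary_mul] at hz
    rw [Subtype.ext hz, map_mul, toProjective_scalar, one_mul]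

lemma TorusRelations.projective_comm {m : ℕ} {Θ : Matrix (Fin m) (Fin m) ℝ}
    {u : Fin m → unitary B} (h : TorusRelations Θ u) (i j : Fin m) :
    toProjective B (u i) * toProjective B (u j) = toProjective B (u j) * toProjective B (u i) := by
  rw [← map_mul, TorusRelations.group.1 h j i, map_mul, toProjective_scalar, one_mul, map_mul]

lemma TorusRelations.exists_monomial_mul {m : ℕ} {Θ : Matrix (Fin m) (Fin m) ℝ}
    {u : Fin m → unitary B} (h : TorusRelations Θ u) (x y : Fin m → ℤ) :
    ∃ z : Circle, ((monomial u x : unitary B) * (monomial u y : unitary B) : B) =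
      (z : ℂ) • ((monomial u (x + y) : unitary B) : B) := by
  refine (toProjective_eq_iff (a := monomial u x * monomial u y)).1 ?_
  rw [map_mul, map_monomial, map_monomial, map_monomial, monomial_add_of_comm h.projective_comm]

lemma TorusRelations.exists_star_monomial {m : ℕ} {Θ : Matrix (Fin m) (Fin m) ℝ}
    {u : Fin m → unitary B} (h : TorusRelations Θ u) (x : Fin m → ℤ) :
    ∃ z : Circle, star ((monomial u x : unitary B) : B) =
      (z : ℂ) • ((monomial u (-x) : unitary B) : B) := by
  refine (toProjective_eq_iff (a := (monomial u x)⁻¹)).1 ?_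
  rw [map_inv, map_monomial, map_monomial, monomial_neg_of_comm h.projective_comm]

end Phases

lemma monomial_zero {m : ℕ} {C : Type*} [Group C] (u : Fin m → C) : monomial u 0 = 1 := by
  simp [monomial]

/-! ### Ordered monomials in the noncommutative torus -/

namespace NCTorus

variable {m : ℕ} (Θ : Matrix (Fin m) (Fin m) ℝ)

lemma torusRelations : TorusRelations Θ (NCTorus.U Θ) := by
  intro j k
  ext r
  exact r.rel j k

/-- The ordered monomial `U^x` as an element of `A_Θ`. -/
def mono (x : Fin m → ℤ) : NCTorus Θ := (monomial (NCTorus.U Θ) x : unitary (NCTorus Θ))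

lemma mono_zero : mono Θ 0 = 1 := by
  rw [mono, monomial_zero]; rfl

lemma mono_single (j : Fin m) : mono Θ (Pi.single j 1) = (NCTorus.U Θ j : NCTorus Θ) := by
  rw [mono, monomial_single]

lemma exists_mono_mul (x y : Fin m → ℤ) :
    ∃ z : Circle, mono Θ x * mono Θ y = (z : ℂ) • mono Θ (x + y) :=
  (torusRelations Θ).exists_monomial_mul x y

lemma exists_star_mono (x : Fin m → ℤ) :
    ∃ z : Circle, star (mono Θ x) = (z : ℂ) • mono Θ (-x) :=
  (torusRelations Θ).exists_star_monomial x

/-- The linear span of the ordered monomials, a ⋆-subalgebra. -/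
def polynomials : StarSubalgebra ℂ (NCTorus Θ) where
  carrier := Submodule.span ℂ (Set.range (mono Θ))
  mul_mem' := by
    intro a b ha hb
    induction ha using Submodule.span_induction with
    | zero => simp
    | add a a' _ _ h h' => simpa [add_mul] using add_mem h h'
    | smul c a _ h => simpa using Submodule.smul_mem _ c h
    | mem a ha =>
      obtain ⟨x, rfl⟩ := ha
      induction hb using Submodule.span_induction with
      | zero => simp
      | add a a' _ _ h h' => simpa [mul_add] using add_mem h h'
      | smul c a _ h => simpa using Submodule.smul_mem _ c h
      | mem b hb =>
        obtain ⟨y, rfl⟩ := hb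
        obtain ⟨z, hz⟩ := exists_mono_mul Θ x y
        rw [hz]
        exact Submodule.smul_mem _ _ (Submodule.subset_span ⟨_, rfl⟩)
  add_mem' := fun ha hb => add_mem ha hb
  algebraMap_mem' c := by
    rw [Algebra.algebraMap_eq_smul_one, ← mono_zero]
    exact Submodule.smul_mem _ _ (Submodule.subset_span ⟨_, rfl⟩)
  star_mem' := by
    intro a ha
    induction ha using Submodule.span_induction with
    | zero => simp
    | add a a' _ _ h h' => simpa using add_mem h h'
    | smul c a _ h => simpa using Submodule.smul_mem _ _ h
    | mem a ha =>
      obtain ⟨x, rfl⟩ := ha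
      obtain ⟨z, hz⟩ := exists_star_mono Θ x
      rw [hz]
      exact Submodule.smul_mem _ _ (Submodule.subset_span ⟨_, rfl⟩)

/-- The span is a ⋆-subalgebra containing the generators, hence contains the ⋆-algebra whose closure
defines `A_Θ`. -/
lemma dense_span_mono :
    Dense (Submodule.span ℂ (Set.range (mono Θ)) : Set (NCTorus Θ)) := by
  have h1 : StarAlgebra.adjoin ℂ
      (Set.range fun j => (tautologicalUnitary Θ j : lp (fun r : TorusModel Θ => r.B) ∞)) ≤
      (polynomials Θ).map (NCTorus Θ).subtype := by
    rw [StarAlgebra.adjoin_le_iff]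
    rintro _ ⟨j, rfl⟩
    refine ⟨(NCTorus.U Θ j : NCTorus Θ), ?_, rfl⟩
    exact Submodule.subset_span ⟨Pi.single j 1, mono_single Θ j⟩
  intro a
  rw [Topology.IsInducing.subtypeVal.closure_eq_preimage_closure_image]
  exact closure_mono h1 a.2

variable {Θ}

/-- Continuous linear maps on `A_Θ` are determined by their values on the monomials. -/
lemma ext_mono {E : Type*} [NormedAddCommGroup E] [NormedSpace ℂ E] {f g : NCTorus Θ →L[ℂ] E}
    (h : ∀ x, f (mono Θ x) = g (mono Θ x)) : f = g :=
  ContinuousLinearMap.ext_on (dense_span_mono Θ) (by rintro _ ⟨x, rfl⟩; exact h x)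

end NCTorus

/-- A ⋆-homomorphism between C⋆-algebras as a continuous linear map. -/
def starHomCLM {A B : Type*} [CStarAlgebra A] [CStarAlgebra B] (f : A →⋆ₐ[ℂ] B) : A →L[ℂ] B :=
  LinearMap.mkContinuous (f : A →ₗ[ℂ] B) 1 fun a => by
    rw [one_mul]
    exact NonUnitalStarAlgHom.norm_apply_le f a

@[simp] lemma starHomCLM_apply {A B : Type*} [CStarAlgebra A] [CStarAlgebra B] (f : A →⋆ₐ[ℂ] B)
    (a : A) : starHomCLM f a = f a := rfl

/-- A ⋆-homomorphism sending generators to phases times monomials sends monomials to phases times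
monomials. -/
lemma TorusRelations.exists_map_monomial {m n : ℕ} {A B : Type*} [CStarAlgebra A] [CStarAlgebra B]
    {Ψ : Matrix (Fin n) (Fin n) ℝ} {v : Fin n → unitary B} (hv : TorusRelations Ψ v)
    (u : Fin m → unitary A) (M : Matrix (Fin n) (Fin m) ℤ) (z : Fin m → Circle) (f : A →⋆ₐ[ℂ] B)
    (hf : ∀ j, f (u j : A) = (z j : ℂ) • ((monomial v fun i => M i j : unitary B) : B))
    (x : Fin m → ℤ) :
    ∃ c : Circle, f ((monomial u x : unitary A) : A) =
      (c : ℂ) • ((monomial v (M *ᵥ x) : unitary B) : B) := by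
  refine (toProjective_eq_iff (a := unitaryMap f (monomial u x))).1 ?_
  rw [map_monomial, map_monomial, map_monomial, ← monomial_mulVec_of_comm hv.projective_comm]
  congr 1
  ext j
  rw [← map_monomial, toProjective_eq_iff]
  exact ⟨z j, hf j⟩

/-- Scalars are central, so multiplying a scalar by a unitary is a group homomorphism on the product
group, and monomials are natural under homomorphisms. -/
lemma monomial_scalar_mul {m : ℕ} {B : Type*} [CStarAlgebra B] (t : Fin m → Circle)
    (u : Fin m → unitary B) (x : Fin m → ℤ) :
    monomial (fun j => scalarUnitary B (t j) * u j) x =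
      scalarUnitary B (monomial t x) * monomial u x := by
  let f : Circle × unitary B →* unitary B :=
    { toFun := fun p => scalarUnitary B p.1 * p.2
      map_one' := by simp
      map_mul' := by
        rintro ⟨s, b⟩ ⟨s', b'⟩
        change scalarUnitary B (s * s') * (b * b') = _ * _ * (_ * _)
        rw [map_mul, mul_assoc, mul_assoc, ← mul_assoc b, ← scalarUnitary_comm, mul_assoc] }
  have h := map_monomial f (fun j => (t j, u j)) x
  have h1 := map_monomial (MonoidHom.fst Circle (unitary B)) (fun j => (t j, u j)) x
  have h2 := map_monomial (MonoidHom.snd Circle (unitary B)) (fun j => (t j, u j)) x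
  refine h.symm.trans ?_
  exact congrArg₂ (fun a b => scalarUnitary B a * b) h1 h2

/-- `φ_{M,z}(U^x)` is a phase times `V^{Mx}`. -/
lemma exists_toricHom_mono {m n : ℕ} {Θ : Matrix (Fin m) (Fin m) ℝ}
    {Ψ : Matrix (Fin n) (Fin n) ℝ} {M : Matrix (Fin n) (Fin m) ℤ} (z : Fin m → Circle)
    (h : ToricCongruence Θ Ψ M) (x : Fin m → ℤ) :
    ∃ c : Circle, toricHom z h (NCTorus.mono Θ x) = (c : ℂ) • NCTorus.mono Ψ (M *ᵥ x) :=
  (NCTorus.torusRelations Ψ).exists_map_monomial (NCTorus.U Θ) M z (toricHom z h)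
    (toricHom_U z h) x

/-- `φ_{1,t}(U^x) = t^x U^x`. -/
lemma toricHom_one_mono {m : ℕ} {Θ : Matrix (Fin m) (Fin m) ℝ} (t : Fin m → Circle)
    (h : ToricCongruence Θ Θ 1) (x : Fin m → ℤ) :
    toricHom t h (NCTorus.mono Θ x) = ((monomial t x : Circle) : ℂ) • NCTorus.mono Θ x := by
  have h1 : (fun j => unitaryMap (toricHom t h) (NCTorus.U Θ j)) =
      fun j => scalarUnitary _ (t j) * NCTorus.U Θ j := by
    ext j : 2
    have h2 : (fun i => (1 : Matrix (Fin m) (Fin m) ℤ) i j) = Pi.single j 1 := by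
      ext k; simp [Matrix.one_apply, Pi.single_apply]
    have h3 := toricHom_U t h j
    rw [h2, monomial_single] at h3
    exact h3.trans (coe_scalarUnitary_mul _ _).symm
  have h2 := (map_monomial (unitaryMap (toricHom t h)) (NCTorus.U Θ) x).trans
    ((congrArg (fun u => monomial u x) h1).trans (monomial_scalar_mul t (NCTorus.U Θ) x))
  exact (congrArg Subtype.val h2).trans (coe_scalarUnitary_mul _ _)

/-! ### Phased translations -/

/-- `W (δ_y ⊗ ξ)` is a phase, depending on `y` only, times `δ_{a+y} ⊗ ξ`. -/
def IsPhasedTranslation {G S : Type} [Add G] [NormedAddCommGroup S] [InnerProductSpace ℂ S]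
    (a : G) (W : L2 G S →L[ℂ] L2 G S) : Prop :=
  ∀ y : G, ∃ p : Circle, ∀ ξ : S, W (delta y ξ) = (p : ℂ) • delta (a + y) ξ

/-- `π_Θ(U^x)` is a phased translation by `x`. -/
lemma regularRep_mono {m : ℕ} {Θ : Matrix (Fin m) (Fin m) ℝ} (hΘ : Θᵀ = -Θ) (S : Type)
    [NormedAddCommGroup S] [InnerProductSpace ℂ S] [CompleteSpace S] [Nontrivial S]
    (x : Fin m → ℤ) : IsPhasedTranslation x (regularRep hΘ S (NCTorus.mono Θ x)) := by
  -- Pairs of a unitary and the label by which it translates form a subgroup. It contains the pairs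
  -- `(U_j, e_j)`, hence their ordered monomial, whose components are `U^x` and `x`.
  let P : Subgroup (unitary (L2 (Fin m → ℤ) S →L[ℂ] L2 (Fin m → ℤ) S) ×
      Multiplicative (Fin m → ℤ)) :=
    { carrier := {p | IsPhasedTranslation p.2.toAdd
        (p.1 : L2 (Fin m → ℤ) S →L[ℂ] L2 (Fin m → ℤ) S)}
      one_mem' := fun y => ⟨1, fun ξ => by simp⟩
      mul_mem' := by
        rintro ⟨W, a⟩ ⟨W', a'⟩ h h' y
        obtain ⟨p', hp'⟩ := h' y
        obtain ⟨p, hp⟩ := h (a'.toAdd + y)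
        refine ⟨p' * p, fun ξ => ?_⟩
        change (W : L2 (Fin m → ℤ) S →L[ℂ] L2 (Fin m → ℤ) S)
          ((W' : L2 (Fin m → ℤ) S →L[ℂ] L2 (Fin m → ℤ) S) _) = _
        simp only at hp hp'
        rw [hp', map_smul, hp, smul_smul, Circle.coe_mul]
        simp [add_assoc]
      inv_mem' := by
        rintro ⟨W, a⟩ h y
        obtain ⟨p, hp⟩ := h (-a.toAdd + y)
        refine ⟨p⁻¹, fun ξ => ?_⟩
        have h1 := hp ξ
        simp only [add_neg_cancel_left] at h1
        have h2 : (delta y ξ : L2 (Fin m → ℤ) S) = ((p⁻¹ : Circle) : ℂ) •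
            (W : L2 (Fin m → ℤ) S →L[ℂ] L2 (Fin m → ℤ) S) (delta (-a.toAdd + y) ξ) := by
          rw [h1, smul_smul, ← Circle.coe_mul, inv_mul_cancel, Circle.coe_one, one_smul]
        have h3 : ∀ f, ((W⁻¹ : unitary _) : L2 (Fin m → ℤ) S →L[ℂ] L2 (Fin m → ℤ) S)
            ((W : L2 (Fin m → ℤ) S →L[ℂ] L2 (Fin m → ℤ) S) f) = f := fun f =>
          DFunLike.congr_fun (congrArg Subtype.val (inv_mul_cancel W)) f
        change ((W⁻¹ : unitary _) : L2 (Fin m → ℤ) S →L[ℂ] L2 (Fin m → ℤ) S) _ = _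
        rw [h2, map_smul, h3]
        rfl }
  have hP : monomial (fun j => ((unitaryMap (regularRep hΘ S) (NCTorus.U Θ j),
      Multiplicative.ofAdd (Pi.single j 1)) : unitary (L2 (Fin m → ℤ) S →L[ℂ] L2 (Fin m → ℤ) S) ×
      Multiplicative (Fin m → ℤ))) x ∈ P :=
    Subgroup.list_prod_mem _ (by
      intro a ha
      obtain ⟨i, rfl⟩ := List.mem_ofFn.1 ha
      refine P.zpow_mem ?_ _
      exact fun y => ⟨cocycle Θ (Pi.single i 1) y, fun ξ => regularRep_U hΘ S i y ξ⟩)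
  have h1 := map_monomial (MonoidHom.fst (unitary (L2 (Fin m → ℤ) S →L[ℂ] L2 (Fin m → ℤ) S))
    (Multiplicative (Fin m → ℤ))) (fun j => ((unitaryMap (regularRep hΘ S) (NCTorus.U Θ j),
      Multiplicative.ofAdd (Pi.single j 1)))) x
  have h2 := map_monomial (MonoidHom.snd (unitary (L2 (Fin m → ℤ) S →L[ℂ] L2 (Fin m → ℤ) S))
    (Multiplicative (Fin m → ℤ))) (fun j => ((unitaryMap (regularRep hΘ S) (NCTorus.U Θ j),
      Multiplicative.ofAdd (Pi.single j 1)))) x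
  have h3 : (monomial (fun k : Fin m => Multiplicative.ofAdd (Pi.single k (1 : ℤ))) x).toAdd = x := by
    simp only [monomial, List.prod_ofFn, toAdd_prod, toAdd_zpow, toAdd_ofAdd]
    ext i
    simp [Finset.sum_apply, Pi.single_apply]
  have h4 : IsPhasedTranslation (Multiplicative.toAdd (MonoidHom.snd _ _ _))
    ((MonoidHom.fst (unitary (L2 (Fin m → ℤ) S →L[ℂ] L2 (Fin m → ℤ) S)) _ _ :
      unitary (L2 (Fin m → ℤ) S →L[ℂ] L2 (Fin m → ℤ) S)) :
      L2 (Fin m → ℤ) S →L[ℂ] L2 (Fin m → ℤ) S) := hP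
  rw [h1, h2] at h4
  simp only [MonoidHom.coe_fst, MonoidHom.coe_snd] at h4
  rw [h3, ← map_monomial] at h4
  exact h4

/-! ### The gauge action and faithfulness of the regular representation -/

/-- On a neighbourhood `O` of `x` one has `f ≥ f x - ε`, so by positivity `μ(O) (f x - ε) ≤ ∫ f =
0`. As `O` has positive measure, `0 ≤ f x ≤ ε`, which bounds the norm. -/
lemma eq_zero_of_integral_eq_zero {A X : Type*} [CStarAlgebra A] [PartialOrder A]
    [StarOrderedRing A] [TopologicalSpace X] [MeasurableSpace X] [BorelSpace X] (μ : Measure X)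
    [μ.IsOpenPosMeasure] [IsFiniteMeasure μ] {f : X → A} (hc : Continuous f)
    (hi : Integrable f μ) (h0 : ∀ x, 0 ≤ f x) (h : ∫ x, f x ∂μ = 0) (x : X) : f x = 0 := by
  have key : ∀ ε : ℝ, 0 < ε → ‖f x‖ ≤ ε := by
    intro ε hε
    let O : Set X := {y | ‖f y - f x‖ < ε}
    have hO : IsOpen O := isOpen_lt (by fun_prop) continuous_const
    have hpos : 0 < μ.real O :=
      ENNReal.toReal_pos (hO.measure_pos μ ⟨x, by simpa [O] using hε⟩).ne' (measure_ne_top _ _)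
    have h1 : ∫ y in O, (f x - algebraMap ℝ A ε) ∂μ ≤ ∫ y in O, f y ∂μ := by
      refine setIntegral_mono_on (integrable_const _).integrableOn hi.integrableOn
        hO.measurableSet fun y hy => ?_
      have h2 : IsSelfAdjoint (f x - f y) :=
        (IsSelfAdjoint.of_nonneg (h0 x)).sub (IsSelfAdjoint.of_nonneg (h0 y))
      have h3 : f x - f y ≤ algebraMap ℝ A ε := by
        refine (h2.le_algebraMap_norm_self).trans (algebraMap_mono A ?_)
        rw [norm_sub_rev]
        exact le_of_lt hy
      rw [sub_le_iff_le_add] at h3 ⊢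
      rwa [add_comm]
    have h2 : ∫ y in O, f y ∂μ ≤ ∫ y, f y ∂μ := by
      rw [← integral_add_compl hO.measurableSet hi]
      exact le_add_of_nonneg_right (integral_nonneg h0)
    have h3 := h1.trans h2
    rw [h, setIntegral_const] at h3
    have h4 : f x - algebraMap ℝ A ε ≤ 0 := by
      have := smul_le_smul_of_nonneg_left h3 (inv_nonneg.2 hpos.le)
      rwa [smul_smul, inv_mul_cancel₀ hpos.ne', one_smul, smul_zero] at this
    exact (CStarAlgebra.norm_le_iff_le_algebraMap (f x) hε.le (h0 x)).2 (sub_nonpos.1 h4)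
  exact norm_le_zero_iff.1 (le_of_forall_pos_le_add fun ε hε => by simpa using key ε hε)

section Averaging

variable {A H I X : Type*} [CStarAlgebra A] [NormedAddCommGroup H] [InnerProductSpace ℂ H]
  [CompleteSpace H] [TopologicalSpace X] {b : I → A} {p : I → X → ℂ} {α : X → A →⋆ₐ[ℂ] A}

/-- On the span of the eigenvectors the orbit map is a finite sum of continuous scalar functions
times vectors. Each `α t` is contractive, so approximating `a` from the span approximates its orbit
uniformly in `t`. -/
lemma continuous_of_eigenvectors (hb : Dense (Submodule.span ℂ (Set.range b) : Set A))
    (hp : ∀ i, Continuous (p i)) (hα : ∀ t i, α t (b i) = p i t • b i) (a : A) :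
    Continuous fun t => α t a := by
  have h1 : ∀ a ∈ Submodule.span ℂ (Set.range b), Continuous fun t => α t a := by
    intro a ha
    induction ha using Submodule.span_induction with
    | zero => simpa using continuous_const
    | add a a' _ _ h h' =>
      simp only [map_add]
      exact h.add h'
    | smul c a _ h =>
      simp only [map_smul]
      exact h.const_smul c
    | mem a ha =>
      obtain ⟨i, rfl⟩ := ha
      simp only [hα]
      exact (hp i).smul continuous_const
  refine continuous_of_uniform_approx_of_continuous fun u hu => ?_
  obtain ⟨ε, hε, hu⟩ := Metric.mem_uniformity_dist.1 hu
  obtain ⟨c, hc, hac⟩ := Metric.dense_iff.1 hb a ε hε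
  refine ⟨_, h1 c hac, fun t => hu ?_⟩
  rw [dist_eq_norm, ← map_sub]
  refine (NonUnitalStarAlgHom.norm_apply_le (α t) (a - c)).trans_lt ?_
  rwa [← dist_eq_norm, dist_comm]

/-- A representation with a vector state that is the average over a compact family of endomorphisms
diagonalized by a total family is faithful. -/
theorem injective_of_average [CompactSpace X] [SecondCountableTopology X] [MeasurableSpace X]
    [BorelSpace X] (μ : Measure X) [μ.IsOpenPosMeasure] [IsFiniteMeasure μ]
    (hb : Dense (Submodule.span ℂ (Set.range b) : Set A))
    (hp : ∀ i, Continuous (p i)) (hα : ∀ t i, α t (b i) = p i t • b i) (i₀ : I) (hb₀ : b i₀ = 1)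
    (hp₀ : ∀ t, p i₀ t = 1) (hint : ∀ i ≠ i₀, ∫ t, p i t ∂μ = 0) (t₀ : X) (ht₀ : ∀ a, α t₀ a = a)
    (ρ : A →⋆ₐ[ℂ] (H →L[ℂ] H)) (v : H) (hv : v ≠ 0)
    (horth : ∀ i ≠ i₀, inner ℂ v (ρ (b i) v) = 0) : Function.Injective ρ := by
  have hcont := continuous_of_eigenvectors hb hp hα
  have hi : ∀ a, Integrable (fun t => α t a) μ := fun a =>
    (hcont a).integrable_of_hasCompactSupport (HasCompactSupport.of_compactSpace _)
  let avg : A →L[ℂ] A := LinearMap.mkContinuous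
    { toFun := fun a => ∫ t, α t a ∂μ
      map_add' := fun a b => by
        simp only [map_add]
        exact integral_add (hi a) (hi b)
      map_smul' := fun c a => by
        simp only [map_smul]
        exact integral_smul c _ } (μ.real Set.univ) fun a => by
      rw [mul_comm]
      exact norm_integral_le_of_norm_le_const (Filter.Eventually.of_forall fun t =>
        NonUnitalStarAlgHom.norm_apply_le (α t) a)
  let tr : A →L[ℂ] ℂ := (innerSL ℂ v).comp
    ((ContinuousLinearMap.apply ℂ _ v).comp (starHomCLM ρ))
  -- The average and the vector state both kill every `b i` with `i ≠ i₀`, and at `b i₀ = 1` they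
  -- differ by the constants shown; so they are proportional on a total set.
  have h : inner ℂ v v • avg = ((μ.real Set.univ : ℂ) • tr).smulRight (1 : A) := by
    refine ContinuousLinearMap.ext_on hb ?_
    rintro _ ⟨i, rfl⟩
    change inner ℂ v v • ∫ t, α t (b i) ∂μ =
      ((μ.real Set.univ : ℂ) * inner ℂ v (ρ (b i) v)) • (1 : A)
    simp only [hα]
    rw [integral_smul_const]
    by_cases hii : i = i₀
    · subst hii
      have h1 : ∫ t, p i t ∂μ = (μ.real Set.univ : ℂ) := by simp [hp₀]
      rw [h1, hb₀, map_one, one_apply_eq_self, smul_smul, mul_comm]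
    · simp [hint i hii, horth i hii]
  rw [injective_iff_map_eq_zero]
  intro a ha
  -- The order serves to regard `α t (star a * a)` as a nonnegative function of `t`. If `ρ a = 0`,
  -- its integral vanishes, hence so does its value at `t₀`, which is `star a * a`.
  let := CStarAlgebra.spectralOrder A
  have := CStarAlgebra.spectralOrderedRing A
  have h1 : inner ℂ v v • ∫ t, α t (star a * a) ∂μ =
      ((μ.real Set.univ : ℂ) * inner ℂ v (ρ (star a * a) v)) • (1 : A) :=
    DFunLike.congr_fun h (star a * a)
  rw [map_mul, ha, mul_zero, zero_apply, inner_zero_right, mul_zero, zero_smul, smul_eq_zero] at h1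
  have h2 := eq_zero_of_integral_eq_zero μ (hcont (star a * a)) (hi _)
    (fun t => by rw [map_mul, map_star]; exact star_mul_self_nonneg _)
    (h1.resolve_left fun h => hv (inner_self_eq_zero.1 h)) t₀
  rw [ht₀] at h2
  exact CStarRing.star_mul_self_eq_zero_iff a |>.1 h2

end Averaging

section Gauge

variable {m : ℕ} (Θ : Matrix (Fin m) (Fin m) ℝ)

lemma toricCongruence_one : ToricCongruence Θ Θ 1 :=
  ⟨0, by simp, by simp⟩

/-- The gauge action of the torus on `A_Θ`. -/
def gauge (t : Fin m → Circle) : NCTorus Θ →⋆ₐ[ℂ] NCTorus Θ :=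
  toricHom t (toricCongruence_one Θ)

lemma gauge_mono (t : Fin m → Circle) (x : Fin m → ℤ) :
    gauge Θ t (NCTorus.mono Θ x) = ((monomial t x : Circle) : ℂ) • NCTorus.mono Θ x :=
  toricHom_one_mono t _ x

lemma continuous_monomial (x : Fin m → ℤ) :
    Continuous fun t : Fin m → Circle => monomial t x := by
  simp only [monomial_eq_prod]
  fun_prop

lemma gauge_one (a : NCTorus Θ) : gauge Θ 1 a = a := by
  have h : starHomCLM (gauge Θ 1) = ContinuousLinearMap.id ℂ (NCTorus Θ) :=
    NCTorus.ext_mono fun x => by simp [gauge_mono, monomial_eq_prod]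
  exact DFunLike.congr_fun h a

lemma exists_monomial_ne_one {x : Fin m → ℤ} (hx : x ≠ 0) :
    ∃ t : Fin m → Circle, monomial t x ≠ 1 := by
  obtain ⟨j, hj⟩ := Function.ne_iff.1 hx
  -- With this single nontrivial coordinate the monomial takes the value `exp(iπ) = -1`.
  refine ⟨Pi.mulSingle j (Circle.exp (Real.pi / x j)), ?_⟩
  rw [monomial_eq_prod, Finset.prod_eq_single j]
  · have h1 : Circle.exp (Real.pi / x j) ^ x j = Circle.exp Real.pi := by
      have h2 := map_zsmul Circle.expHom (x j) (Real.pi / x j)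
      have h3 : x j • (Real.pi / x j) = Real.pi := by
        rw [zsmul_eq_mul, mul_div_cancel₀ _ (by exact_mod_cast hj)]
      rw [h3] at h2
      exact h2.symm
    rw [Pi.mulSingle_eq_same, h1]
    intro h2
    have h3 := congrArg (fun z : Circle => (z : ℂ)) h2
    norm_num [Circle.coe_exp, Complex.exp_pi_mul_I] at h3
  · intro i _ hij; simp [hij]
  · simp

instance torusMeasurableSpace : MeasurableSpace (Fin m → Circle) := borel _

instance torusBorelSpace : BorelSpace (Fin m → Circle) := ⟨rfl⟩

/-- The monomial is a nontrivial character. Translating by `s` multiplies its integral by `monomial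
s x ≠ 1`, while Haar measure is invariant. -/
lemma integral_monomial {x : Fin m → ℤ} (hx : x ≠ 0) :
    ∫ t : Fin m → Circle, ((monomial t x : Circle) : ℂ) ∂Measure.haar = 0 := by
  obtain ⟨s, hs⟩ := exists_monomial_ne_one hx
  have h1 : ∫ t : Fin m → Circle, ((monomial (s * t) x : Circle) : ℂ) ∂Measure.haar =
      ∫ t : Fin m → Circle, ((monomial t x : Circle) : ℂ) ∂Measure.haar :=
    integral_mul_left_eq_self (fun t => ((monomial t x : Circle) : ℂ)) s
  have h2 : ∀ t, monomial (s * t) x = monomial s x * monomial t x := by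
    intro t
    simp [monomial_eq_prod, mul_zpow, Finset.prod_mul_distrib]
  simp only [h2, Circle.coe_mul, integral_const_mul] at h1
  by_contra h3
  exact hs (Circle.ext (by simpa using mul_right_cancel₀ h3 (h1.trans (one_mul _).symm)))

variable {Θ} (hΘ : Θᵀ = -Θ) {S : Type} [NormedAddCommGroup S] [InnerProductSpace ℂ S]
  [CompleteSpace S] [Nontrivial S]

/-- The left regular representation of `A_Θ` is faithful. -/
theorem regularRep_injective : Function.Injective (regularRep hΘ S) := by
  obtain ⟨ξ, hξ⟩ := exists_ne (0 : S)
  refine injective_of_average (Measure.haar : Measure (Fin m → Circle)) (NCTorus.dense_span_mono Θ)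
    (p := fun x t => ((monomial t x : Circle) : ℂ))
    (fun x => continuous_subtype_val.comp (continuous_monomial x)) (gauge_mono Θ) 0
    (NCTorus.mono_zero Θ) (fun t => by simp [monomial_zero]) (fun x hx => integral_monomial hx) 1
    (gauge_one Θ) (regularRep hΘ S) (delta 0 ξ) (fun h => hξ ?_) (fun x hx => ?_)
  · rw [← norm_eq_zero, ← norm_delta (0 : Fin m → ℤ) ξ, h, norm_zero]
  · obtain ⟨p, hp⟩ := regularRep_mono hΘ S x 0
    rw [hp, inner_smul_right, add_zero, inner_delta_of_ne (Ne.symm hx), mul_zero]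

end Gauge

/-! ### The isometries induced by toric homomorphisms -/

/-- A matrix implementing a congruence with a nondegenerate matrix is injective. -/
lemma mulVec_injective {m n : ℕ} {Θ : Matrix (Fin m) (Fin m) ℝ} {Ψ : Matrix (Fin n) (Fin n) ℝ}
    {M : Matrix (Fin n) (Fin m) ℤ} (hΘ : Nondegenerate Θ) (h : ToricCongruence Θ Ψ M) :
    Function.Injective M.mulVec := by
  have h0 : Function.Injective M.mulVecLin := by
    rw [injective_iff_map_eq_zero]
    intro x hx
    -- If `M x = 0`, the congruence reduces `⟨x, Θ y⟩` to the integer `⟨x, K y⟩` for every `y`, and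
    -- nondegeneracy applies.
    refine hΘ x fun y => ?_
    obtain ⟨K, -, hK⟩ := h
    have hx' : (fun j => (x j : ℝ)) ᵥ* (M.map (Int.cast : ℤ → ℝ))ᵀ = 0 := by
      rw [Matrix.vecMul_transpose]
      ext i
      have h1 := congrArg (fun k : ℤ => (k : ℝ)) (congrFun hx i)
      simpa [Matrix.mulVec, dotProduct] using h1
    have h2 : (fun j => (x j : ℝ)) ⬝ᵥ (Θ *ᵥ fun k => (y k : ℝ)) =
        ((x ⬝ᵥ (K *ᵥ y) : ℤ) : ℝ) := by
      rw [sub_eq_iff_eq_add.1 hK, Matrix.add_mulVec, dotProduct_add,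
        Matrix.dotProduct_mulVec _ (_ * _ * _), Matrix.mul_assoc, ← Matrix.vecMul_vecMul, hx']
      simp [Matrix.mulVec, dotProduct]
    rw [h2, e_int]
  exact h0

section Pushforward

variable {G G' S : Type} [NormedAddCommGroup S] [InnerProductSpace ℂ S] [CompleteSpace S]

/-- An injection of labels and a family of phases induce an isometry. -/
lemma exists_pushforward {f : G → G'} (hf : Function.Injective f) (c : G → Circle) :
    ∃ I : L2 G S →ₗᵢ[ℂ] L2 G' S, ∀ x ξ, I (delta x ξ) = (c x : ℂ) • delta (f x) ξ := by
  classical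
  let v : ∀ _ : G, S →ₗᵢ[ℂ] L2 G' S := fun x =>
    { toLinearMap := (c x : ℂ) • (deltaIsometry S (f x)).toLinearMap
      norm_map' := fun ξ => by
        change ‖(c x : ℂ) • delta (f x) ξ‖ = ‖ξ‖
        rw [norm_smul, Circle.norm_coe, one_mul, norm_delta] }
  -- Injectivity of `f` is what keeps the images of different summands orthogonal.
  have hv : OrthogonalFamily ℂ (fun _ : G => S) v := by
    intro x y hxy ξ η
    change inner ℂ ((c x : ℂ) • delta (f x) ξ) ((c y : ℂ) • delta (f y) η) = 0
    rw [inner_smul_left, inner_smul_right, inner_delta_of_ne (hf.ne hxy), mul_zero, mul_zero]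
  refine ⟨hv.linearIsometry, fun x ξ => ?_⟩
  refine Eq.trans ?_ (hv.linearIsometry_apply_single (i := x) ξ)
  unfold delta
  congr!

end Pushforward

namespace ToricSystem

variable (T : ToricSystem) {S : Type} [NormedAddCommGroup S] [InnerProductSpace ℂ S]
  [CompleteSpace S] [Nontrivial S]

variable (S) in
-- The GNS vector of `U^x` is only a phase `p` times `δ_x`. Keeping `p` as a common factor exhibits
-- `c` as the coefficient that a GNS isometry must have at `δ_x`, and neither phase depends on `ξ`.
lemma exists_gns_phase (n : ℕ) (x : T.Label n) : ∃ p c : Circle, ∀ ξ : S,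
    T.Λ n (NCTorus.mono (T.Θ n) x) ξ = (p : ℂ) • delta x ξ ∧
      T.Λ (n + 1) (T.φ n (NCTorus.mono (T.Θ n) x)) ξ =
        (p : ℂ) • (c : ℂ) • delta ((T.M n).mulVec x) ξ := by
  obtain ⟨p, hp⟩ := regularRep_mono (T.skew n) S x 0
  obtain ⟨c, hc⟩ := exists_toricHom_mono (T.z n) (T.congruence n) x
  obtain ⟨q, hq⟩ := regularRep_mono (T.skew (n + 1)) S ((T.M n).mulVec x) 0
  refine ⟨p, p⁻¹ * (c * q), fun ξ => ⟨?_, ?_⟩⟩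
  · exact (hp ξ).trans (by rw [add_zero])
  · have h1 : T.Λ (n + 1) (T.φ n (NCTorus.mono (T.Θ n) x)) ξ = (c : ℂ) •
        (regularRep (T.skew (n + 1)) S (NCTorus.mono (T.Θ (n + 1)) ((T.M n).mulVec x)))
          (delta 0 ξ) := by
      unfold Λ π φ
      rw [hc, map_smul]
      rfl
    rw [h1, hq, smul_smul, smul_smul, ← Circle.coe_mul, ← Circle.coe_mul, mul_inv_cancel_left,
      add_zero]

/-- The GNS vector as a continuous linear function of the algebra element. -/
def ΛCLM (n : ℕ) (ξ : S) : T.A n →L[ℂ] T.H S n :=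
  (ContinuousLinearMap.apply ℂ _ (delta 0 ξ)).comp (starHomCLM (T.π S n))

/-- The isometry is prescribed on each `δ_x` by the phase that `U^x` forces. Both sides of the GNS
identity are continuous and linear in `a`, so monomials suffice. -/
lemma exists_isGNSIsometry : ∃ I : ∀ n, T.H S n →ₗᵢ[ℂ] T.H S (n + 1), T.IsGNSIsometry I := by
  choose p c hpc using T.exists_gns_phase S
  choose I hI using fun n =>
    exists_pushforward (S := S) (mulVec_injective (T.nondegenerate n) (T.congruence n)) (c n)
  refine ⟨I, fun n a ξ => ?_⟩
  have h : (I n).toContinuousLinearMap.comp (T.ΛCLM n ξ) =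
      (T.ΛCLM (n + 1) ξ).comp (starHomCLM (T.φ n)) := by
    refine NCTorus.ext_mono fun x => ?_
    change I n (T.Λ n _ ξ) = T.Λ (n + 1) (T.φ n _) ξ
    rw [(hpc n x ξ).1, (hpc n x ξ).2, map_smul, hI]
  exact DFunLike.congr_fun h a

variable {T} {I : ∀ n, T.H S n →ₗᵢ[ℂ] T.H S (n + 1)}

lemma exists_delta_eq_Λ (n : ℕ) (x : T.Label n) : ∃ p : Circle, ∀ ξ : S,
    delta x ξ = (p : ℂ) • T.Λ n (NCTorus.mono (T.Θ n) x) ξ := by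
  obtain ⟨p, _, hp⟩ := T.exists_gns_phase S n x
  refine ⟨p⁻¹, fun ξ => ?_⟩
  rw [(hp ξ).1, smul_smul, ← Circle.coe_mul, inv_mul_cancel, Circle.coe_one, one_smul]

lemma IsGNSIsometry.exists_phase (hI : T.IsGNSIsometry I) (n : ℕ) (x : T.Label n) :
    ∃ c : Circle, ∀ ξ : S, I n (delta x ξ) = (c : ℂ) • delta ((T.M n).mulVec x) ξ := by
  obtain ⟨p, c, h⟩ := T.exists_gns_phase S n x
  refine ⟨c, fun ξ => ?_⟩
  have h1 := hI n (NCTorus.mono (T.Θ n) x) ξ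
  rw [(h ξ).1, (h ξ).2, map_smul] at h1
  exact smul_right_injective _ (Circle.coe_ne_zero p) h1

lemma IsGNSIsometry.eq {I' : ∀ n, T.H S n →ₗᵢ[ℂ] T.H S (n + 1)} (hI : T.IsGNSIsometry I)
    (hI' : T.IsGNSIsometry I') : I = I' := by
  ext n : 1
  have h : (I n).toContinuousLinearMap = (I' n).toContinuousLinearMap := by
    refine ext_delta fun x ξ => ?_
    obtain ⟨p, hp⟩ := exists_delta_eq_Λ (S := S) n x
    change I n _ = I' n _
    rw [hp, map_smul, map_smul, hI, hI']
  ext η : 1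
  exact DFunLike.congr_fun h η

/-- The isometries intertwine the regular representations. -/
lemma IsGNSIsometry.map_rep (hI : T.IsGNSIsometry I) (n : ℕ) (a : T.A n) (η : T.H S n) :
    I n (T.π S n a η) = T.π S (n + 1) (T.φ n a) (I n η) := by
  have h : (I n).toContinuousLinearMap.comp (T.π S n a) =
      (T.π S (n + 1) (T.φ n a)).comp (I n).toContinuousLinearMap := by
    refine ext_delta fun x ξ => ?_
    obtain ⟨p, hp⟩ := exists_delta_eq_Λ (S := S) n x
    change I n (T.π S n a _) = T.π S (n + 1) (T.φ n a) (I n _)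
    -- On GNS vectors the representation is left multiplication, so intertwining follows from
    -- multiplicativity of the connecting map.
    have h1 : ∀ (k : ℕ) (b b' : T.A k), T.π S k b (T.Λ k b' ξ) = T.Λ k (b * b') ξ := by
      intro k b b'
      unfold Λ
      rw [map_mul]
      rfl
    rw [hp]
    simp only [map_smul]
    rw [h1, hI, hI, h1, map_mul]
  exact DFunLike.congr_fun h η

end ToricSystem

/-! ### Coordinates and multipliers -/

section Coordinates

variable {G G' S : Type} [NormedAddCommGroup S] [InnerProductSpace ℂ S]

variable (S) in
/-- The coordinate at `g`, as a continuous linear map. -/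
abbrev coord (g : G) : L2 G S →L[ℂ] S := lp.evalCLM ℂ (fun _ : G => S) 2 g

lemma pushforward_apply {f : G → G'} (hf : Function.Injective f) {c : G → Circle}
    {W : L2 G S →L[ℂ] L2 G' S} (hW : ∀ x ξ, W (delta x ξ) = (c x : ℂ) • delta (f x) ξ)
    (η : L2 G S) (x : G) : W η (f x) = (c x : ℂ) • η x := by
  have h : (coord S (f x)).comp W = (c x : ℂ) • coord S x := by
    refine ext_delta fun y ξ => ?_
    change W (delta y ξ) (f x) = (c x : ℂ) • (delta y ξ : L2 G S) x
    rw [hW, lp.coeFn_smul, Pi.smul_apply]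
    by_cases hxy : x = y
    · subst hxy; rw [delta_apply_self, delta_apply_self]
    · rw [delta_apply_ne _ hxy, delta_apply_ne _ (hf.ne hxy), smul_zero, smul_zero]
  exact DFunLike.congr_fun h η

lemma pushforward_apply_of_notMem {f : G → G'} {c : G → Circle}
    {W : L2 G S →L[ℂ] L2 G' S} (hW : ∀ x ξ, W (delta x ξ) = (c x : ℂ) • delta (f x) ξ)
    (η : L2 G S) {y : G'} (hy : y ∉ Set.range f) : W η y = 0 := by
  have h : (coord S y).comp W = 0 := by
    refine ext_delta fun x ξ => ?_
    change W (delta x ξ) y = 0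
    rw [hW, lp.coeFn_smul, Pi.smul_apply, delta_apply_ne _ (fun h => hy ⟨x, h.symm⟩), smul_zero]
  exact DFunLike.congr_fun h η

variable [CompleteSpace S] (F : G → selfAdjoint (S →L[ℂ] S))

/-- The domain condition disappears: if the `F(g) f(g)` are the coordinates of an `ℓ²` vector, then
`f` lies in the maximal domain. Questions about the unbounded operator thus become coordinatewise
identities. -/
lemma mem_graph_multiplier {f h : L2 G S} :
    (f, h) ∈ (multiplier F).graph ↔ ∀ g, h g = (F g : S →L[ℂ] S) (f g) := by
  rw [LinearPMap.mem_graph_iff]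
  constructor
  · rintro ⟨f', rfl, rfl⟩ g
    rfl
  · intro hfh
    have hf : Memℓp (fun g => (F g : S →L[ℂ] S) (f g)) 2 := by
      simpa only [← hfh] using lp.memℓp h
    refine ⟨⟨f, hf⟩, rfl, ?_⟩
    ext g
    exact (hfh g).symm

lemma isClosed_graph_multiplier : IsClosed ((multiplier F).graph : Set (L2 G S × L2 G S)) := by
  have h : ((multiplier F).graph : Set (L2 G S × L2 G S)) =
      ⋂ g, {p | coord S g p.2 = (F g : S →L[ℂ] S) (coord S g p.1)} := by
    ext ⟨f, h⟩
    simp only [SetLike.mem_coe, mem_graph_multiplier, Set.mem_iInter]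
    rfl
  rw [h]
  exact isClosed_iInter fun g => isClosed_eq (by fun_prop) (by fun_prop)

lemma delta_mem_graph_multiplier (g : G) (ξ : S) :
    (delta g ξ, delta g ((F g : S →L[ℂ] S) ξ)) ∈ (multiplier F).graph := by
  rw [mem_graph_multiplier]
  intro h
  by_cases hgh : h = g
  · subst hgh; rw [delta_apply_self, delta_apply_self]
  · rw [delta_apply_ne _ hgh, delta_apply_ne _ hgh, map_zero]

/-- The finitely supported vectors form a core for the multiplier. -/
lemma graph_multiplier_le {K : Submodule ℂ (L2 G S × L2 G S)}
    (hK : IsClosed (K : Set (L2 G S × L2 G S)))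
    (h : ∀ g ξ, (delta g ξ, delta g ((F g : S →L[ℂ] S) ξ)) ∈ K) : (multiplier F).graph ≤ K := by
  rintro ⟨f, f'⟩ hf
  rw [mem_graph_multiplier] at hf
  refine hK.mem_of_tendsto ((hasSum_delta f).prodMk (hasSum_delta f'))
    (Filter.Eventually.of_forall fun _ => K.sum_mem fun g _ => ?_)
  rw [hf]
  exact h g (f g)

end Coordinates

/-! ### The Hilbert space inductive limit -/

section HilbertLimit

variable {H : ℕ → Type} [∀ n, NormedAddCommGroup (H n)] [∀ n, InnerProductSpace ℂ (H n)]
  (I : ∀ n, H n →ₗᵢ[ℂ] H (n + 1))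

lemma toHilbertLimit_transition {n k : ℕ} (h : n ≤ k) (η : H n) :
    toHilbertLimit I k (isometryTransition I n k h η) = toHilbertLimit I n η :=
  congrArg (fun x : PreHilbertLimit I => (x : HilbertLimit I))
    (DirectLimit.mk_apply n k η h)

lemma toHilbertLimit_succ (n : ℕ) (η : H n) :
    toHilbertLimit I (n + 1) (I n η) = toHilbertLimit I n η := by
  rw [← toHilbertLimit_transition I (Nat.le_succ n) η,
    isometryTransition_succ I n n le_rfl (Nat.le_succ n)]
  simp [isometryTransition]

variable {I}

/-- A closed subspace containing the images of all late stages is everything. -/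
lemma mem_of_toHilbertLimit_mem {K : Submodule ℂ (HilbertLimit I)}
    (hK : IsClosed (K : Set (HilbertLimit I))) (n : ℕ)
    (h : ∀ k, n ≤ k → ∀ η, toHilbertLimit I k η ∈ K) (x : HilbertLimit I) : x ∈ K := by
  refine UniformSpace.Completion.induction_on x hK fun y => ?_
  obtain ⟨k, η, rfl⟩ := DirectLimit.exists_eq_mk (isometryTransition I) y
  have h1 := toHilbertLimit_transition I (le_max_right n k) η
  have h2 : toHilbertLimit I k η ∈ K := h1 ▸ h _ (le_max_left n k) _
  exact h2

lemma ext_toHilbertLimit {E : Type*} [NormedAddCommGroup E] [NormedSpace ℂ E]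
    {T T' : HilbertLimit I →L[ℂ] E} (n : ℕ)
    (h : ∀ k, n ≤ k → ∀ η, T (toHilbertLimit I k η) = T' (toHilbertLimit I k η)) : T = T' := by
  ext x : 1
  exact mem_of_toHilbertLimit_mem (K := LinearMap.eqLocus T.toLinearMap T'.toLinearMap)
    (isClosed_eq T.continuous T'.continuous) n h x

end HilbertLimit

/-! ### The label group and its stage maps. -/

namespace ToricSystem

variable (T : ToricSystem)

lemma labelTransition_injective (n k : ℕ) (h : n ≤ k) :
    Function.Injective (T.labelTransition n k h) := by
  induction k, h using Nat.le_induction with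
  | base => intro x y hxy; simpa [labelTransition] using hxy
  | succ k h ih =>
    rw [T.labelTransition_succ n k h]
    exact (mulVec_injective (T.nondegenerate k) (T.congruence k)).comp ih

lemma label_injective (n : ℕ) : Function.Injective (T.label n) :=
  DirectLimit.mk_injective T.labelTransition T.labelTransition_injective n

lemma label_transition {n k : ℕ} (h : n ≤ k) (x : T.Label n) :
    T.label k (T.labelTransition n k h x) = T.label n x :=
  DirectLimit.mk_apply n k x h

lemma exists_label (g : T.G) : ∃ n x, T.label n x = g := by
  obtain ⟨n, x, h⟩ := DirectLimit.exists_eq_mk T.labelTransition g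
  exact ⟨n, x, h.symm⟩

lemma label_add (n : ℕ) (x y : T.Label n) : T.label n (x + y) = T.label n x + T.label n y :=
  (DirectLimit.add_def n x y).symm

/-- A compatible family of functions on the labels descends to the limit. -/
lemma exists_limit_function {C : Type*} (F : ∀ n, T.Label n → C)
    (hF : ∀ n (x : T.Label n), F (n + 1) ((T.M n).mulVec x) = F n x) :
    ∃ Finf : T.G → C, ∀ n x, Finf (T.label n x) = F n x := by
  refine ⟨DirectLimit.lift T.labelTransition F fun n k h x => ?_, fun n x => rfl⟩
  induction k, h using Nat.le_induction with
  | base => simp [labelTransition]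
  | succ k h ih =>
    rw [T.labelTransition_succ n k h, ih]
    exact (hF k _).symm

variable {T} {S : Type} [NormedAddCommGroup S] [InnerProductSpace ℂ S] [CompleteSpace S]
  {I : ∀ n, T.H S n →ₗᵢ[ℂ] T.H S (n + 1)}

/-! ### Identification of the limit Hilbert space with `ℓ²(G_∞) ⊗ S`. -/

section LimitUnitary

variable [Nontrivial S]

lemma IsGNSIsometry.exists_limit_phase (hI : T.IsGNSIsometry I) {n k : ℕ} (h : n ≤ k)
    (x : T.Label n) : ∃ c : Circle, ∀ ξ : S, toHilbertLimit I n (delta x ξ) =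
      (c : ℂ) • toHilbertLimit I k (delta (T.labelTransition n k h x) ξ) := by
  induction k, h using Nat.le_induction with
  | base => exact ⟨1, fun ξ => by simp [labelTransition]⟩
  | succ k h ih =>
    obtain ⟨c, hc⟩ := ih
    obtain ⟨c', hc'⟩ := hI.exists_phase k (T.labelTransition n k h x)
    refine ⟨c * c', fun ξ => ?_⟩
    rw [hc, ← toHilbertLimit_succ, hc', map_smul, smul_smul, Circle.coe_mul,
      T.labelTransition_succ n k h]
    rfl

/-- Both vectors are moved to the stage `max n n'`. Stage maps into `G_∞` are injective, so labels
equal in the limit are already equal there. -/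
lemma IsGNSIsometry.exists_phase_of_label_eq (hI : T.IsGNSIsometry I) {n n' : ℕ} {x : T.Label n}
    {x' : T.Label n'} (h : T.label n x = T.label n' x') : ∃ c : Circle, ∀ ξ : S,
      toHilbertLimit I n (delta x ξ) = (c : ℂ) • toHilbertLimit I n' (delta x' ξ) := by
  obtain ⟨c, hc⟩ := hI.exists_limit_phase (le_max_left n n') x
  obtain ⟨c', hc'⟩ := hI.exists_limit_phase (le_max_right n n') x'
  have h1 : T.labelTransition n (max n n') (le_max_left n n') x =
      T.labelTransition n' (max n n') (le_max_right n n') x' := by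
    apply T.label_injective
    rw [T.label_transition, T.label_transition, h]
  refine ⟨c * c'⁻¹, fun ξ => ?_⟩
  rw [hc, hc', h1, smul_smul, ← Circle.coe_mul, inv_mul_cancel_right]

lemma IsGNSIsometry.inner_eq_zero (hI : T.IsGNSIsometry I) {n n' : ℕ} {x : T.Label n}
    {x' : T.Label n'} (h : T.label n x ≠ T.label n' x') (ξ ξ' : S) :
    inner ℂ (toHilbertLimit I n (delta x ξ)) (toHilbertLimit I n' (delta x' ξ')) = 0 := by
  obtain ⟨c, hc⟩ := hI.exists_limit_phase (le_max_left n n') x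
  obtain ⟨c', hc'⟩ := hI.exists_limit_phase (le_max_right n n') x'
  have h1 : T.labelTransition n (max n n') (le_max_left n n') x ≠
      T.labelTransition n' (max n n') (le_max_right n n') x' := by
    intro h1
    apply h
    rw [← T.label_transition (le_max_left n n') x, h1, T.label_transition]
  rw [hc, hc', inner_smul_left, inner_smul_right, LinearIsometry.inner_map_map,
    inner_delta_of_ne h1, mul_zero, mul_zero]

/-- The unitary `H_pro ≃ ℓ²(G_∞) ⊗ S`. -/
theorem IsGNSIsometry.exists_unitary (hI : T.IsGNSIsometry I) :
    ∃ (V : HilbertLimit I ≃ₗᵢ[ℂ] L2 T.G S) (χ : ∀ n, T.Label n → Circle),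
      ∀ n (x : T.Label n) (ξ : S),
        V (toHilbertLimit I n (delta x ξ)) = (χ n x : ℂ) • delta (T.label n x) ξ := by
  classical
  -- One representative `(r g, y g)` is fixed for each label `g`; its summand becomes the copy of
  -- `S` at `g`. The phase `χ n x` compares `δ_x` at stage `n` with the representative of `[x, n]`.
  choose r y hy using T.exists_label
  let v : ∀ _ : T.G, S →ₗᵢ[ℂ] HilbertLimit I := fun g =>
    (toHilbertLimit I (r g)).comp (deltaIsometry S (y g))
  have hv : OrthogonalFamily ℂ (fun _ : T.G => S) v := fun g g' hg ξ ξ' =>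
    hI.inner_eq_zero (by rwa [hy, hy]) ξ ξ'
  choose χ hχ using fun n (x : T.Label n) =>
    hI.exists_phase_of_label_eq (hy (T.label n x)).symm
  -- Totality: every stage vector `δ_x ⊗ ξ` is a phase times a vector in a chosen summand.
  have hs : IsHilbertSum ℂ (fun _ : T.G => S) v := by
    refine IsHilbertSum.mk hv fun z _ => ?_
    refine mem_of_toHilbertLimit_mem (Submodule.isClosed_topologicalClosure _) 0
      (fun n _ η => ?_) z
    refine mem_of_delta_mem (K := (Submodule.topologicalClosure
      (⨆ g, LinearMap.range (v g).toLinearMap)).comap (toHilbertLimit I n).toLinearMap)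
      ((Submodule.isClosed_topologicalClosure _).preimage (toHilbertLimit I n).continuous)
      (fun x ξ => ?_) η
    change toHilbertLimit I n (delta x ξ) ∈
      (⨆ g, LinearMap.range (v g).toLinearMap).topologicalClosure
    rw [hχ]
    refine Submodule.smul_mem _ _ (Submodule.le_topologicalClosure _ ?_)
    exact le_iSup (fun g => LinearMap.range (v g).toLinearMap) (T.label n x) ⟨ξ, rfl⟩
  refine ⟨hs.linearIsometryEquiv, χ, fun n x ξ => ?_⟩
  have h1 : hs.linearIsometryEquiv.symm (delta (T.label n x) ξ) = v (T.label n x) ξ := by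
    refine Eq.trans ?_ (hs.linearIsometryEquiv_symm_apply_single (i := T.label n x) ξ)
    unfold delta
    congr!
  rw [hχ, map_smul]
  congr 1
  exact (LinearIsometryEquiv.symm_apply_eq _).1 h1 |>.symm

end LimitUnitary

/-! ### The closure of the stage operators. -/

section LimitOperator

variable {V : HilbertLimit I ≃ₗᵢ[ℂ] L2 T.G S} {χ : ∀ n, T.Label n → Circle}
  {F : ∀ n, T.Label n → selfAdjoint (S →L[ℂ] S)} {Finf : T.G → selfAdjoint (S →L[ℂ] S)}

/-- The graph of `D_{F_∞}`, transported to `H_pro`. -/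
def pulledGraph (V : HilbertLimit I ≃ₗᵢ[ℂ] L2 T.G S) (Finf : T.G → selfAdjoint (S →L[ℂ] S)) :
    Submodule ℂ (HilbertLimit I × HilbertLimit I) :=
  (multiplier Finf).graph.comap (V.toLinearEquiv.toLinearMap.prodMap V.toLinearEquiv.toLinearMap)

lemma mem_pulledGraph {η ζ : HilbertLimit I} :
    (η, ζ) ∈ pulledGraph V Finf ↔ (V η, V ζ) ∈ (multiplier Finf).graph := Iff.rfl

lemma isClosed_pulledGraph :
    IsClosed (pulledGraph V Finf : Set (HilbertLimit I × HilbertLimit I)) :=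
  (isClosed_graph_multiplier Finf).preimage (V.continuous.prodMap V.continuous)

lemma pulledGraph_single_valued (x : HilbertLimit I × HilbertLimit I)
    (hx : x ∈ pulledGraph V Finf) (hx1 : x.1 = 0) : x.2 = 0 := by
  have h1 := (mem_graph_multiplier Finf).1 hx
  refine (LinearIsometryEquiv.map_eq_zero_iff V).1 ?_
  ext g
  have h2 : V x.2 g = (Finf g : S →L[ℂ] S) (V x.1 g) := h1 g
  rwa [hx1, map_zero, lp.coeFn_zero, Pi.zero_apply, map_zero] at h2

/-- The map from stage `n` to `ℓ²(G_∞) ⊗ S` multiplies the coordinate at `x` by a phase, which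
commutes with `F n x`, and puts zero at labels outside the stage. The equations defining the
multiplier graph therefore persist. -/
lemma limitGraph_le_pulledGraph (hV : ∀ n (x : T.Label n) (ξ : S),
      V (toHilbertLimit I n (delta x ξ)) = (χ n x : ℂ) • delta (T.label n x) ξ)
    (hF : ∀ n (x : T.Label n), Finf (T.label n x) = F n x) :
    limitGraph I (fun n => multiplier (F n)) ≤ pulledGraph V Finf := by
  refine iSup_le fun n => ?_
  rintro _ ⟨⟨f, h⟩, hfh, rfl⟩
  have h1 := (mem_graph_multiplier (F n)).1 hfh
  refine (mem_graph_multiplier Finf).2 fun g => ?_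
  let W : T.H S n →L[ℂ] L2 T.G S :=
    (V.toLinearIsometry.comp (toHilbertLimit I n)).toContinuousLinearMap
  change W h g = (Finf g : S →L[ℂ] S) (W f g)
  by_cases hg : g ∈ Set.range (T.label n)
  · obtain ⟨x, rfl⟩ := hg
    rw [pushforward_apply (T.label_injective n) (hV n), pushforward_apply (T.label_injective n)
      (hV n), map_smul, hF, h1]
  · rw [pushforward_apply_of_notMem (hV n) _ hg, pushforward_apply_of_notMem (hV n) _ hg, map_zero]

lemma delta_mem_limitGraph (n : ℕ) (x : T.Label n) (ξ : S) :
    (toHilbertLimit I n (delta x ξ), toHilbertLimit I n (delta x ((F n x : S →L[ℂ] S) ξ))) ∈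
      limitGraph I (fun n => multiplier (F n)) :=
  le_iSup (fun n => (multiplier (F n)).graph.map
    ((toHilbertLimit I n).toLinearMap.prodMap (toHilbertLimit I n).toLinearMap)) n
    ⟨_, delta_mem_graph_multiplier (F n) x ξ, rfl⟩

/-- One inclusion holds because the pulled-back graph is closed. For the other, the core of
`D_{F_∞}` consists of vectors already present at some stage, up to an inverse phase. -/
lemma pulledGraph_eq_closure (hV : ∀ n (x : T.Label n) (ξ : S),
      V (toHilbertLimit I n (delta x ξ)) = (χ n x : ℂ) • delta (T.label n x) ξ)
    (hF : ∀ n (x : T.Label n), Finf (T.label n x) = F n x) :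
    (limitGraph I (fun n => multiplier (F n))).topologicalClosure = pulledGraph V Finf := by
  refine le_antisymm (Submodule.topologicalClosure_minimal _ (limitGraph_le_pulledGraph hV hF)
    isClosed_pulledGraph) ?_
  rintro ⟨η, ζ⟩ h
  have h1 : (multiplier Finf).graph ≤
      ((limitGraph I (fun n => multiplier (F n))).topologicalClosure).comap
        (V.symm.toLinearEquiv.toLinearMap.prodMap V.symm.toLinearEquiv.toLinearMap) := by
    refine graph_multiplier_le Finf ((Submodule.isClosed_topologicalClosure _).preimage
      (V.symm.continuous.prodMap V.symm.continuous)) fun g ξ => ?_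
    obtain ⟨n, x, rfl⟩ := T.exists_label g
    have h2 : ∀ ξ : S, V.symm (delta (T.label n x) ξ) =
        ((χ n x)⁻¹ : ℂ) • toHilbertLimit I n (delta x ξ) := by
      intro ξ
      rw [LinearIsometryEquiv.symm_apply_eq, map_smul, hV, smul_smul,
        inv_mul_cancel₀ (Circle.coe_ne_zero _), one_smul]
    change (V.symm (delta (T.label n x) ξ),
      V.symm (delta (T.label n x) ((Finf (T.label n x) : S →L[ℂ] S) ξ))) ∈
      (limitGraph I (fun n => multiplier (F n))).topologicalClosure
    rw [h2, h2, hF, ← Prod.smul_mk]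
    exact Submodule.smul_mem _ _ (Submodule.le_topologicalClosure _ (delta_mem_limitGraph n x ξ))
  have h2 : (V.symm (V η), V.symm (V ζ)) ∈
      (limitGraph I (fun n => multiplier (F n))).topologicalClosure := h1 h
  rwa [V.symm_apply_apply, V.symm_apply_apply] at h2

/-- A subspace of a single-valued graph is single-valued, and here the closure is single-valued too.
The domain is dense because it contains the vectors `δ_x ⊗ ξ` of every stage. -/
theorem limitOperatorWellDefined (hV : ∀ n (x : T.Label n) (ξ : S),
      V (toHilbertLimit I n (delta x ξ)) = (χ n x : ℂ) • delta (T.label n x) ξ)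
    (hF : ∀ n (x : T.Label n), Finf (T.label n x) = F n x) :
    LimitOperatorWellDefined I (fun n => multiplier (F n)) := by
  have h1 : (limitCoreOperator I fun n => multiplier (F n)).graph =
      limitGraph I fun n => multiplier (F n) :=
    Submodule.toLinearPMap_graph_eq _ fun x hx =>
      pulledGraph_single_valued (V := V) (Finf := Finf) x (limitGraph_le_pulledGraph hV hF hx)
  refine ⟨h1, ?_, (pulledGraph V Finf).toLinearPMap, ?_⟩
  · have h2 : (limitCoreOperator I fun n => multiplier (F n)).domain.topologicalClosure = ⊤ := by
      rw [eq_top_iff]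
      intro z _
      refine mem_of_toHilbertLimit_mem (Submodule.isClosed_topologicalClosure _) 0
        (fun n _ η => ?_) z
      refine mem_of_delta_mem (K := (Submodule.topologicalClosure
        (limitCoreOperator I fun n => multiplier (F n)).domain).comap
          (toHilbertLimit I n).toLinearMap)
        ((Submodule.isClosed_topologicalClosure _).preimage (toHilbertLimit I n).continuous)
        (fun x ξ => Submodule.le_topologicalClosure _ ?_) η
      exact LinearPMap.mem_domain_of_mem_graph (h1 ▸ delta_mem_limitGraph n x ξ)
    exact Submodule.dense_iff_topologicalClosure_eq_top.2 h2
  · rw [h1, pulledGraph_eq_closure hV hF, Submodule.toLinearPMap_graph_eq]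
    exact pulledGraph_single_valued

/-- `V D_pro V⋆ = D_{F_∞}`. -/
theorem mem_graph_limitOperator (hV : ∀ n (x : T.Label n) (ξ : S),
      V (toHilbertLimit I n (delta x ξ)) = (χ n x : ℂ) • delta (T.label n x) ξ)
    (hF : ∀ n (x : T.Label n), Finf (T.label n x) = F n x) (η ζ : HilbertLimit I) :
    (η, ζ) ∈ (limitOperator I fun n => multiplier (F n)).graph ↔
      (V η, V ζ) ∈ (multiplier Finf).graph := by
  have h := limitOperatorWellDefined hV hF
  rw [limitOperator, ← h.2.2.graph_closure_eq_closure_graph, h.1, pulledGraph_eq_closure hV hF]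
  exact mem_pulledGraph
end LimitOperator

end ToricSystem

/-! ### Operators on the Hilbert space inductive limit -/

section LimitMap

variable {H : ℕ → Type} [∀ n, NormedAddCommGroup (H n)] [∀ n, InnerProductSpace ℂ (H n)]
  {I : ∀ n, H n →ₗᵢ[ℂ] H (n + 1)}

/-- A compatible bounded family of maps out of the stages extends to the limit. -/
lemma exists_limit_map {E : Type*} [NormedAddCommGroup E] [NormedSpace ℂ E] [CompleteSpace E]
    (f : ∀ n, H n →L[ℂ] E)
    (hf : ∀ n k (h : n ≤ k) η, f n η = f k (isometryTransition I n k h η)) (C : ℝ)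
    (hC : ∀ n η, ‖f n η‖ ≤ C * ‖η‖) :
    ∃ T : HilbertLimit I →L[ℂ] E, ∀ n η, T (toHilbertLimit I n η) = f n η := by
  let g₀ : PreHilbertLimit I → E :=
    DirectLimit.lift (isometryTransition I) (fun n η => f n η) hf
  have hg₀ : ∀ n η, g₀ (toPreHilbertLimit I n η) = f n η := fun n η => rfl
  have hx : ∀ x : PreHilbertLimit I, ∃ n η, x = toPreHilbertLimit I n η :=
    DirectLimit.exists_eq_mk (isometryTransition I)
  have hxy : ∀ x y : PreHilbertLimit I, ∃ n η ζ,
      x = toPreHilbertLimit I n η ∧ y = toPreHilbertLimit I n ζ :=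
    DirectLimit.exists_eq_mk₂ (isometryTransition I)
  let g : PreHilbertLimit I →ₗ[ℂ] E :=
    { toFun := g₀
      map_add' := by
        intro x y
        obtain ⟨n, η, ζ, rfl, rfl⟩ := hxy x y
        rw [← map_add, hg₀, hg₀, hg₀, map_add]
      map_smul' := by
        intro c x
        obtain ⟨n, η, rfl⟩ := hx x
        rw [← map_smul, hg₀, hg₀, map_smul, RingHom.id_apply] }
  let ι : PreHilbertLimit I →ₗ[ℂ] HilbertLimit I :=
    (UniformSpace.Completion.toComplₗᵢ (𝕜 := ℂ) (E := PreHilbertLimit I)).toLinearMap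
  refine ⟨g.extendOfNorm ι, fun n η => ?_⟩
  refine LinearMap.extendOfNorm_eq (f := g) (e := ι) UniformSpace.Completion.denseRange_coe
    ⟨C, fun x => ?_⟩ (toPreHilbertLimit I n η)
  obtain ⟨n, η, rfl⟩ := hx x
  change ‖f n η‖ ≤ C * ‖((toPreHilbertLimit I n η : PreHilbertLimit I) : HilbertLimit I)‖
  rw [UniformSpace.Completion.norm_coe, norm_toPreHilbertLimit]
  exact hC n η

lemma transition_intertwines {n : ℕ} {B : ∀ k, n ≤ k → H k →L[ℂ] H k}
    (hB : ∀ k (h : n ≤ k) η, I k (B k h η) = B (k + 1) (Nat.le_succ_of_le h) (I k η))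
    {k l : ℕ} (h : n ≤ k) (h' : k ≤ l) (η : H k) :
    isometryTransition I k l h' (B k h η) = B l (h.trans h') (isometryTransition I k l h' η) := by
  induction l, h' using Nat.le_induction with
  | base => simp [isometryTransition]
  | succ l h' ih =>
    rw [isometryTransition_succ I k l h']
    change I l (isometryTransition I k l h' _) = B (l + 1) _ (I l (isometryTransition I k l h' η))
    rw [ih, hB]

/-- A compatible bounded family of operators on late stages extends to the limit. -/
lemma exists_limit_operator (n : ℕ) (B : ∀ k, n ≤ k → H k →L[ℂ] H k)
    (hB : ∀ k (h : n ≤ k) η, I k (B k h η) = B (k + 1) (Nat.le_succ_of_le h) (I k η)) (C : ℝ)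
    (hC : ∀ k h, ‖B k h‖ ≤ C) :
    ∃ T : HilbertLimit I →L[ℂ] HilbertLimit I,
      ∀ k (h : n ≤ k) η, T (toHilbertLimit I k η) = toHilbertLimit I k (B k h η) := by
  have key : ∀ k l (h : n ≤ k) (h' : k ≤ l) (η : H k), toHilbertLimit I k (B k h η) =
      toHilbertLimit I l (B l (h.trans h') (isometryTransition I k l h' η)) := by
    intro k l h h' η
    rw [← transition_intertwines hB, toHilbertLimit_transition]
  -- `B` is only given from stage `n` on, so a vector of stage `k` is first moved to stage `max n
  -- k`.
  let f : ∀ k, H k →L[ℂ] HilbertLimit I := fun k =>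
    (toHilbertLimit I (max n k)).toContinuousLinearMap.comp
      ((B (max n k) (le_max_left n k)).comp
        (isometryTransition I k (max n k) (le_max_right n k)).toContinuousLinearMap)
  have hf : ∀ i j (h : i ≤ j) η, f i η = f j (isometryTransition I i j h η) := by
    intro i j h η
    change toHilbertLimit I (max n i) (B _ _ (isometryTransition I i _ _ η)) =
      toHilbertLimit I (max n j) (B _ _ (isometryTransition I j _ _ _))
    rw [key (max n i) (max n j) _ (max_le_max le_rfl h)]
    congr 2
    exact (DirectedSystem.map_map' (isometryTransition I) _ _ η).trans
      (DirectedSystem.map_map' (isometryTransition I) _ _ η).symm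
  have hfC : ∀ k η, ‖f k η‖ ≤ C * ‖η‖ := by
    intro k η
    change ‖toHilbertLimit I (max n k) (B _ _ (isometryTransition I k _ _ η))‖ ≤ _
    rw [LinearIsometry.norm_map]
    refine ((B _ _).le_opNorm _).trans ?_
    rw [LinearIsometry.norm_map]
    exact mul_le_mul_of_nonneg_right (hC _ _) (norm_nonneg _)
  obtain ⟨T, hT⟩ := exists_limit_map f hf C hfC
  refine ⟨T, fun k h η => ?_⟩
  rw [hT, key k (max n k) h (le_max_right n k)]
  rfl

end LimitMap

/-! ### The representation of the limit algebra -/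

section LimitRep

variable {A : ℕ → Type*} [∀ n, CStarAlgebra (A n)] (φ : ∀ n, A n →⋆ₐ[ℂ] A (n + 1))

/-- The composition `φ_{k-1} ∘ ⋯ ∘ φ_n : A_n → A_k`. -/
def homTransition (n k : ℕ) (h : n ≤ k) : A n →⋆ₐ[ℂ] A k :=
  Nat.leRec (motive := fun k _ => A n →⋆ₐ[ℂ] A k) (StarAlgHom.id ℂ (A n))
    (fun k _ f => (φ k).comp f) h

lemma homTransition_self (n : ℕ) (a : A n) : homTransition φ n n le_rfl a = a := by
  simp [homTransition]

lemma homTransition_succ (n k : ℕ) (h : n ≤ k) (h' : n ≤ k + 1) (a : A n) :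
    homTransition φ n (k + 1) h' a = φ k (homTransition φ n k h a) :=
  DFunLike.congr_fun (Nat.leRec_succ (motive := fun k _ => A n →⋆ₐ[ℂ] A k) _ _ h) a

lemma homTransition_step (n k : ℕ) (h : n + 1 ≤ k) (a : A n) :
    homTransition φ (n + 1) k h (φ n a) = homTransition φ n k (Nat.le_of_succ_le h) a := by
  induction k, h using Nat.le_induction with
  | base => rw [homTransition_self, homTransition_succ φ n n le_rfl, homTransition_self]
  | succ k h ih =>
    rw [homTransition_succ φ _ k h, ih, homTransition_succ φ n k (Nat.le_of_succ_le h)]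

lemma toCStarLimit_transition (n k : ℕ) (h : n ≤ k) (a : A n) :
    toCStarLimit φ k (homTransition φ n k h a) = toCStarLimit φ n a := by
  induction k, h using Nat.le_induction with
  | base => rw [homTransition_self]
  | succ k h ih => rw [homTransition_succ φ n k h, toCStarLimit_comp, ih]

/-- The images of the stages are dense in the limit algebra. -/
lemma dense_iUnion_range_toCStarLimit :
    Dense (⋃ n, Set.range (toCStarLimit φ n)) := by
  have hmono : Monotone fun n => (toCoconeProd φ n).range := by
    refine monotone_nat_of_le_succ fun n => ?_
    rintro _ ⟨a, rfl⟩
    refine ⟨φ n a, ?_⟩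
    exact congrArg Subtype.val (toCStarLimit_comp φ n a)
  intro x
  rw [Topology.IsInducing.subtypeVal.closure_eq_preimage_closure_image]
  have hx : (x : lp (fun c : CStarCocone φ => c.B) ∞) ∈
      closure ((⨆ n, (toCoconeProd φ n).range : StarSubalgebra ℂ _) : Set _) := x.2
  rw [StarSubalgebra.coe_iSup_of_directed hmono.directed_le] at hx
  refine closure_mono ?_ hx
  rintro _ hy
  obtain ⟨n, a, rfl⟩ := Set.mem_iUnion.1 hy
  exact ⟨toCStarLimit φ n a, Set.mem_iUnion.2 ⟨n, a, rfl⟩, rfl⟩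

variable {H : ℕ → Type} [∀ n, NormedAddCommGroup (H n)] [∀ n, InnerProductSpace ℂ (H n)]
  [∀ n, CompleteSpace (H n)] {I : ∀ n, H n →ₗᵢ[ℂ] H (n + 1)}
  {ρ : ∀ n, A n →⋆ₐ[ℂ] (H n →L[ℂ] H n)}

variable {φ} in
-- An element of stage `n` acts on every later stage through its image there. These operators are
-- bounded by `‖a‖` because ⋆-homomorphisms are contractive, and the algebraic identities are tested
-- on late stages.
lemma exists_stageRep (hρ : ∀ n a η, I n (ρ n a η) = ρ (n + 1) (φ n a) (I n η)) (n : ℕ) :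
    ∃ ψ : A n →⋆ₐ[ℂ] (HilbertLimit I →L[ℂ] HilbertLimit I), ∀ a k (h : n ≤ k) η,
      ψ a (toHilbertLimit I k η) = toHilbertLimit I k (ρ k (homTransition φ n k h a) η) := by
  have hex : ∀ a : A n, ∃ T : HilbertLimit I →L[ℂ] HilbertLimit I, ∀ k (h : n ≤ k) η,
      T (toHilbertLimit I k η) = toHilbertLimit I k (ρ k (homTransition φ n k h a) η) := by
    intro a
    refine exists_limit_operator n (fun k h => ρ k (homTransition φ n k h a)) (fun k h η => ?_) ‖a‖
      fun k h => ?_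
    · rw [hρ, homTransition_succ φ n k h]
    · exact (NonUnitalStarAlgHom.norm_apply_le (ρ k) _).trans
        (NonUnitalStarAlgHom.norm_apply_le (homTransition φ n k h) a)
  choose T hT using hex
  refine ⟨
    { toFun := T
      map_one' := ext_toHilbertLimit n fun k h η => by
        rw [hT _ k h, map_one, map_one]; rfl
      map_mul' := fun a b => ext_toHilbertLimit n fun k h η => by
        rw [hT _ k h, map_mul, map_mul]
        change _ = T a (T b _)
        rw [hT _ k h, hT _ k h]; rfl
      map_zero' := ext_toHilbertLimit n fun k h η => by
        rw [hT _ k h, map_zero, map_zero, zero_apply, zero_apply, map_zero]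
      map_add' := fun a b => ext_toHilbertLimit n fun k h η => by
        rw [hT _ k h, map_add, map_add, add_apply, add_apply, hT _ k h, hT _ k h, map_add]
      commutes' := fun c => ext_toHilbertLimit n fun k h η => by
        rw [hT _ k h, AlgHomClass.commutes (homTransition φ n k h) c, AlgHomClass.commutes (ρ k) c,
          Algebra.algebraMap_eq_smul_one, Algebra.algebraMap_eq_smul_one]
        exact map_smul (toHilbertLimit I k) c η
      map_star' := fun a => ?_ }, hT⟩
  rw [ContinuousLinearMap.star_eq_adjoint, ContinuousLinearMap.eq_adjoint_iff]
  intro x y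
  -- The adjoint identity is reduced to stages one variable at a time: with one vector at stage `k`,
  -- the other is tested only at stages `l ≥ k`, where both can be compared.
  have h1 : (innerSL ℂ y).comp (T (star a)) = innerSL ℂ (T a y) := by
    refine ext_toHilbertLimit n fun k h η => ?_
    change inner ℂ y (T (star a) (toHilbertLimit I k η)) = inner ℂ (T a y) (toHilbertLimit I k η)
    have h2 : innerSL ℂ (T (star a) (toHilbertLimit I k η)) =
        (innerSL ℂ (toHilbertLimit I k η)).comp (T a) := by
      refine ext_toHilbertLimit k fun l h' ζ => ?_
      change inner ℂ (T (star a) (toHilbertLimit I k η)) (toHilbertLimit I l ζ) =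
        inner ℂ (toHilbertLimit I k η) (T a (toHilbertLimit I l ζ))
      rw [← toHilbertLimit_transition I h' η, hT _ l (h.trans h'), hT _ l (h.trans h'),
        LinearIsometry.inner_map_map, LinearIsometry.inner_map_map, map_star, map_star,
        ContinuousLinearMap.star_eq_adjoint, ContinuousLinearMap.adjoint_inner_left]
    have h3 : inner ℂ (T (star a) (toHilbertLimit I k η)) y =
        inner ℂ (toHilbertLimit I k η) (T a y) := DFunLike.congr_fun h2 y
    rw [← inner_conj_symm, h3, inner_conj_symm]
  have h3 : inner ℂ y (T (star a) x) = inner ℂ (T a y) x := DFunLike.congr_fun h1 x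
  change inner ℂ (T (star a) x) y = inner ℂ x (T a y)
  rw [← inner_conj_symm, h3, inner_conj_symm]

variable {φ} in
/-- Compatible representations of the stages induce a unique representation of the limit. -/
theorem existsUnique_limitRep [Nontrivial (H 0)]
    (hρ : ∀ n a η, I n (ρ n a η) = ρ (n + 1) (φ n a) (I n η)) :
    ∃! π : CStarLimit φ →⋆ₐ[ℂ] (HilbertLimit I →L[ℂ] HilbertLimit I), ∀ n (a : A n) (η : H n),
      π (toCStarLimit φ n a) (toHilbertLimit I n η) = toHilbertLimit I n (ρ n a η) := by
  have : Nontrivial (HilbertLimit I) := (toHilbertLimit I 0).injective.nontrivial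
  choose ψ hψ using exists_stageRep hρ
  -- The operators on the limit space are the target of a cocone, hence one factor of the product
  -- defining `CStarLimit`. The representation is evaluation at that factor; nontriviality of `H 0`
  -- makes the target nonzero, as a cocone requires.
  let c : CStarCocone φ :=
    { B := HilbertLimit I →L[ℂ] HilbertLimit I
      ψ := ψ
      compat := fun n a => ext_toHilbertLimit (n + 1) fun k h η => by
        rw [hψ _ _ k h, homTransition_step, hψ _ _ k (Nat.le_of_succ_le h)] }
  let ev : lp (fun c : CStarCocone φ => c.B) ∞ →⋆ₐ[ℂ] (HilbertLimit I →L[ℂ] HilbertLimit I) :=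
    { toFun := fun f => f c
      map_one' := rfl
      map_mul' := fun _ _ => rfl
      map_zero' := rfl
      map_add' := fun _ _ => rfl
      commutes' := fun _ => rfl
      map_star' := fun _ => rfl }
  refine ⟨ev.comp (CStarLimit φ).subtype, fun n a η => ?_, fun π hπ => ?_⟩
  · change ψ n a (toHilbertLimit I n η) = _
    rw [hψ n a n le_rfl, homTransition_self]
  · have h1 : Set.EqOn (starHomCLM π) (starHomCLM (ev.comp (CStarLimit φ).subtype))
        (⋃ n, Set.range (toCStarLimit φ n)) := by
      intro x hx
      obtain ⟨n, a, rfl⟩ := Set.mem_iUnion.1 hx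
      refine ext_toHilbertLimit n fun k h η => ?_
      change π (toCStarLimit φ n a) (toHilbertLimit I k η) = ψ n a (toHilbertLimit I k η)
      rw [hψ n a k h, ← toCStarLimit_transition φ n k h, hπ]
    ext x : 1
    exact congrFun ((starHomCLM π).continuous.ext_on (dense_iUnion_range_toCStarLimit φ)
      (starHomCLM (ev.comp (CStarLimit φ).subtype)).continuous h1) x

variable {φ} in
/-- The induced representation of the limit is faithful if those of the stages are. -/
theorem limitRep_injective (hinj : ∀ n, Function.Injective (ρ n))
    {π : CStarLimit φ →⋆ₐ[ℂ] (HilbertLimit I →L[ℂ] HilbertLimit I)}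
    (hπ : ∀ n (a : A n) (η : H n),
      π (toCStarLimit φ n a) (toHilbertLimit I n η) = toHilbertLimit I n (ρ n a η)) :
    Function.Injective π := by
  -- Injectivity alone need not pass to closures, but this bound does. On stage elements `‖ι_n a‖ ≤
  -- ‖a‖ = ‖ρ_n a‖ ≤ ‖π (ι_n a)‖`, since `ρ_n a` is the restriction of `π (ι_n a)` to stage `n`.
  have h1 : ∀ x : CStarLimit φ, ‖x‖ ≤ ‖starHomCLM π x‖ := by
    intro x
    refine (dense_iUnion_range_toCStarLimit φ).induction
      (P := fun x => ‖x‖ ≤ ‖starHomCLM π x‖) (fun x hx => ?_) ?_ x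
    · obtain ⟨n, a, rfl⟩ := Set.mem_iUnion.1 hx
      refine (NonUnitalStarAlgHom.norm_apply_le (toCStarLimit φ n) a).trans ?_
      rw [← NonUnitalStarAlgHom.norm_map (ρ n) (hinj n) a]
      refine ContinuousLinearMap.opNorm_le_bound _ (norm_nonneg _) fun η => ?_
      rw [← LinearIsometry.norm_map (toHilbertLimit I n), ← hπ,
        ← LinearIsometry.norm_map (toHilbertLimit I n) η]
      exact (π (toCStarLimit φ n a)).le_opNorm _
    · exact isClosed_le continuous_norm (starHomCLM π).continuous.norm
  rw [injective_iff_map_eq_zero]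
  intro x hx
  have h2 := h1 x
  rw [starHomCLM_apply, hx, norm_zero] at h2
  exact norm_le_zero_iff.1 h2

end LimitRep

/-! ### Diagonal operators -/

section Diagonal

variable {G S : Type} [NormedAddCommGroup S] [InnerProductSpace ℂ S]

lemma norm_le_of_coord {f h : L2 G S} {c : ℝ} (hc : 0 ≤ c) (hfh : ∀ g, ‖f g‖ ≤ c * ‖h g‖) :
    ‖f‖ ≤ c * ‖h‖ := by
  have h1 : ‖f‖ ≤ ‖(c : ℂ) • h‖ := lp.norm_mono (by norm_num) fun g => by
    rw [lp.coeFn_smul, Pi.smul_apply, norm_smul, Complex.norm_real, Real.norm_of_nonneg hc]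
    exact hfh g
  rwa [norm_smul, Complex.norm_real, Real.norm_of_nonneg hc] at h1

/-- A bounded family of operators on `S` defines a diagonal operator. -/
lemma exists_diagonal (B : G → S →L[ℂ] S) (C : ℝ) (hC : ∀ g, ‖B g‖ ≤ C) :
    ∃ T : L2 G S →L[ℂ] L2 G S, ∀ f g, T f g = B g (f g) := by
  have hbound : ∀ (f : L2 G S) g, ‖B g (f g)‖ ≤ C * ‖f g‖ := fun f g =>
    ((B g).le_opNorm _).trans (mul_le_mul_of_nonneg_right (hC g) (norm_nonneg _))
  have hmem : ∀ f : L2 G S, Memℓp (fun g => B g (f g)) 2 := fun f =>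
    ((lp.memℓp f).norm.const_mul C).mono (hbound f)
  let T : L2 G S →ₗ[ℂ] L2 G S :=
    { toFun := fun f => ⟨fun g => B g (f g), hmem f⟩
      map_add' := fun f h => by ext g; exact map_add (B g) _ _
      map_smul' := fun c f => by ext g; exact map_smul (B g) _ _ }
  -- For empty `G` the hypothesis does not exclude a negative `C`.
  refine ⟨T.mkContinuous (max C 0) fun f => norm_le_of_coord (le_max_right _ _) fun g => ?_,
    fun f g => rfl⟩
  exact (hbound f g).trans (mul_le_mul_of_nonneg_right (le_max_left _ _) (norm_nonneg _))

/-- The operator restricting vectors to a finite set of labels. -/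
def truncation (E : Finset G) : L2 G S →L[ℂ] L2 G S :=
  ∑ g ∈ E, (deltaIsometry S g).toContinuousLinearMap.comp (coord S g)

lemma truncation_apply (E : Finset G) (f : L2 G S) : truncation E f = ∑ g ∈ E, delta g (f g) := by
  simp only [truncation, sum_apply]
  rfl

lemma truncation_apply_of_mem {E : Finset G} (f : L2 G S) {g : G} (hg : g ∈ E) :
    truncation E f g = f g := by
  rw [truncation_apply, lp.coeFn_sum, Finset.sum_apply, Finset.sum_eq_single g]
  · rw [delta_apply_self]
  · intro h _ hh; rw [delta_apply_ne _ (Ne.symm hh)]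
  · intro h; exact absurd hg h

lemma truncation_apply_of_notMem {E : Finset G} (f : L2 G S) {g : G} (hg : g ∉ E) :
    truncation E f g = 0 := by
  rw [truncation_apply, lp.coeFn_sum, Finset.sum_apply]
  refine Finset.sum_eq_zero fun h hh => delta_apply_ne _ ?_
  rintro rfl
  exact hg hh

/-- Each summand factors through the finite-dimensional space `S`. -/
lemma isCompactOperator_truncation [FiniteDimensional ℂ S] (E : Finset G) :
    IsCompactOperator (truncation E : L2 G S →L[ℂ] L2 G S) := by
  have : ProperSpace S := FiniteDimensional.proper ℂ S
  have h : ∀ g, IsCompactOperator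
      ((deltaIsometry S g).toContinuousLinearMap.comp (coord S g) : L2 G S →L[ℂ] L2 G S) :=
    fun g => ((isCompactOperator_id (E := S)).comp_clm (coord S g)).clm_comp
      (deltaIsometry S g).toContinuousLinearMap
  unfold truncation
  classical
  induction E using Finset.induction_on with
  | empty => simpa using isCompactOperator_zero
  | insert g E hg ih =>
    rw [Finset.sum_insert hg]
    exact (h g).add ih

end Diagonal

/-! ### Selfadjoint operators on a finite-dimensional space -/

section SelfAdjointBounds

variable {S : Type*} [NormedAddCommGroup S] [InnerProductSpace ℂ S] [CompleteSpace S]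

/-- A selfadjoint operator without spectrum in `[-r, r]` is bounded below by `r`. -/
lemma le_norm_apply_of_spectrum {T : S →L[ℂ] S} (hT : IsSelfAdjoint T) {r : ℝ} (hr : 0 < r)
    (h : ¬ ∃ t ∈ Set.Icc (-r) r, (t : ℂ) ∈ spectrum ℂ T) (ξ : S) : r * ‖ξ‖ ≤ ‖T ξ‖ := by
  have h0 : IsUnit T := by
    by_contra h0
    exact h ⟨0, ⟨by linarith, hr.le⟩, by simpa using (spectrum.zero_mem_iff ℂ).2 h0⟩
  obtain ⟨u, rfl⟩ := h0
  have hu : IsSelfAdjoint ((u⁻¹ : (S →L[ℂ] S)ˣ) : S →L[ℂ] S) := by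
    have h1 : star u = u := Units.ext hT
    change star ((u⁻¹ : (S →L[ℂ] S)ˣ) : S →L[ℂ] S) = _
    rw [← Units.coe_star, star_inv, h1]
  have hnorm : ‖((u⁻¹ : (S →L[ℂ] S)ˣ) : S →L[ℂ] S)‖ ≤ r⁻¹ := by
    -- The spectrum of `T` is real and avoids `[-r, r]`, so its inverses have modulus at most `r⁻¹`.
    -- For the selfadjoint inverse the spectral radius is the norm.
    have h2 : spectralRadius ℂ ((u⁻¹ : (S →L[ℂ] S)ˣ) : S →L[ℂ] S) ≤ (r⁻¹).toNNReal := by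
      refine iSup₂_le fun k hk => ?_
      rw [← spectrum.map_inv, Set.mem_inv] at hk
      have h3 := hT.mem_spectrum_eq_re hk
      have h4 : r ≤ ‖k⁻¹‖ := by
        by_contra h5
        push Not at h5
        refine h ⟨(k⁻¹).re, abs_le.1 ?_, h3 ▸ hk⟩
        exact (Complex.abs_re_le_norm _).trans h5.le
      rw [norm_inv] at h4
      have hk0 : 0 < ‖k‖ := inv_pos.1 (hr.trans_le h4)
      have h5 : ‖k‖ ≤ r⁻¹ := (le_inv_comm₀ hr hk0).1 h4
      rw [← enorm_eq_nnnorm, ← ofReal_norm]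
      exact ENNReal.ofReal_le_ofReal h5
    rw [hu.spectralRadius_eq_nnnorm, ENNReal.coe_le_coe] at h2
    have h3 := NNReal.coe_le_coe.2 h2
    rwa [coe_nnnorm, Real.coe_toNNReal _ (inv_nonneg.2 hr.le)] at h3
  have h1 : ((u⁻¹ : (S →L[ℂ] S)ˣ) : S →L[ℂ] S) ((u : S →L[ℂ] S) ξ) = ξ :=
    DFunLike.congr_fun (Units.inv_mul u) ξ
  have h2 := ((u⁻¹ : (S →L[ℂ] S)ˣ) : S →L[ℂ] S).le_of_opNorm_le hnorm ((u : S →L[ℂ] S) ξ)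
  rw [h1, inv_mul_eq_div, le_div_iff₀ hr] at h2
  rwa [mul_comm]

/-- `T - i` has a contractive inverse. -/
lemma exists_inverse_sub_I {T : S →L[ℂ] S} (hT : IsSelfAdjoint T) :
    ∃ B : S →L[ℂ] S, ‖B‖ ≤ 1 ∧ (∀ ξ, B (T ξ - Complex.I • ξ) = ξ) ∧
      ∀ ξ, T (B ξ) - Complex.I • B ξ = ξ := by
  have h0 : Complex.I ∉ spectrum ℂ T := fun h => by
    simpa using hT.im_eq_zero_of_mem_spectrum h
  obtain ⟨u, hu⟩ := spectrum.notMem_iff.1 h0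
  have hu' : ∀ ξ, (u : S →L[ℂ] S) ξ = Complex.I • ξ - T ξ := by
    intro ξ
    rw [hu, Algebra.algebraMap_eq_smul_one]
    rfl
  have h1 : ∀ ξ, ((u⁻¹ : (S →L[ℂ] S)ˣ) : S →L[ℂ] S) ((u : S →L[ℂ] S) ξ) = ξ := fun ξ =>
    DFunLike.congr_fun (Units.inv_mul u) ξ
  have h2 : ∀ ξ, (u : S →L[ℂ] S) (((u⁻¹ : (S →L[ℂ] S)ˣ) : S →L[ℂ] S) ξ) = ξ := fun ξ =>
    DFunLike.congr_fun (Units.mul_inv u) ξ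
  -- As `⟨ξ, T ξ⟩` is real, the imaginary part of `⟨ξ, (i - T) ξ⟩` is `‖ξ‖²`, and Cauchy–Schwarz
  -- gives the bound.
  have h3 : ∀ ξ, ‖ξ‖ ≤ ‖(u : S →L[ℂ] S) ξ‖ := by
    intro ξ
    have h4 : (inner ℂ ξ (T ξ)).im = 0 := by
      have h5 := ContinuousLinearMap.adjoint_inner_left T ξ ξ
      rw [← ContinuousLinearMap.star_eq_adjoint, hT.star_eq, ← inner_conj_symm] at h5
      exact Complex.conj_eq_iff_im.1 h5
    have h5 : (inner ℂ ξ ((u : S →L[ℂ] S) ξ)).im = ‖ξ‖ ^ 2 := by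
      rw [hu', inner_sub_right, Complex.sub_im, h4, inner_smul_right, inner_self_eq_norm_sq_to_K]
      simp [← Complex.ofReal_pow]
    have h6 : ‖ξ‖ ^ 2 ≤ ‖ξ‖ * ‖(u : S →L[ℂ] S) ξ‖ := by
      rw [← h5]
      exact ((le_abs_self _).trans (Complex.abs_im_le_norm _)).trans (norm_inner_le_norm _ _)
    rcases (norm_nonneg ξ).eq_or_lt with h7 | h7
    · rw [← h7]; exact norm_nonneg _
    · rw [sq] at h6
      exact le_of_mul_le_mul_left h6 h7
  -- The unit is `u = i - T`, hence the sign.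
  refine ⟨-((u⁻¹ : (S →L[ℂ] S)ˣ) : S →L[ℂ] S), ?_, fun ξ => ?_, fun ξ => ?_⟩
  · rw [norm_neg]
    refine ContinuousLinearMap.opNorm_le_bound _ zero_le_one fun ξ => ?_
    rw [one_mul]
    exact (h3 _).trans_eq (congrArg norm (h2 ξ))
  · rw [neg_apply, ← map_neg, neg_sub, ← hu', h1]
  · rw [neg_apply, map_neg, smul_neg, sub_neg_eq_add, neg_add_eq_sub, ← hu', h2]

end SelfAdjointBounds

/-! ### Operators unitarily equivalent to multipliers -/

/-- Copies of one nonzero vector in the different summands are linearly independent. This turns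
condition (a) into finiteness of sets of labels. -/
lemma finite_of_finiteDimensional_directSum {ι S : Type*} [AddCommGroup S] [Module ℂ S]
    [Nontrivial S] [FiniteDimensional ℂ (DirectSum ι fun _ => S)] : Finite ι := by
  classical
  obtain ⟨ξ, hξ⟩ := exists_ne (0 : S)
  have h : LinearIndependent ℂ fun i : ι => DirectSum.lof ℂ ι (fun _ => S) i ξ := by
    rw [linearIndependent_iff']
    intro s c hs i hi
    have h1 := congrArg (DirectSum.component ℂ ι (fun _ => S) i) hs
    rw [map_sum, map_zero, Finset.sum_eq_single i] at h1
    · rw [map_smul, DirectSum.component.lof_self] at h1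
      exact (smul_eq_zero.1 h1).resolve_right hξ
    · intro j _ hj
      rw [map_smul, DirectSum.component.of, dif_neg hj, smul_zero]
    · intro h; exact absurd hi h
  exact h.finite

section Diagonalized

variable {G S H : Type} [NormedAddCommGroup S] [InnerProductSpace ℂ S] [CompleteSpace S]
  [NormedAddCommGroup H] [InnerProductSpace ℂ H] {F : G → selfAdjoint (S →L[ℂ] S)} {D : H →ₗ.[ℂ] H} {V : H ≃ₗᵢ[ℂ] L2 G S}

lemma coord_of_graph (hD : ∀ η ζ, (η, ζ) ∈ D.graph ↔ (V η, V ζ) ∈ (multiplier F).graph)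
    (x : D.domain) (g : G) : V (D x) g = (F g : S →L[ℂ] S) (V x g) :=
  (mem_graph_multiplier F).1 ((hD _ _).1 (D.mem_graph x)) g

lemma exists_domain_of_coord (hD : ∀ η ζ, (η, ζ) ∈ D.graph ↔ (V η, V ζ) ∈ (multiplier F).graph)
    {η ζ : H} (h : ∀ g, V ζ g = (F g : S →L[ℂ] S) (V η g)) :
    ∃ hη : η ∈ D.domain, D ⟨η, hη⟩ = ζ := by
  obtain ⟨y, hy, hy'⟩ := D.mem_graph_iff.1 ((hD η ζ).2 ((mem_graph_multiplier F).2 h))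
  obtain ⟨y, hyd⟩ := y
  obtain rfl : y = η := hy
  exact ⟨hyd, hy'⟩

lemma exists_domain_delta (hD : ∀ η ζ, (η, ζ) ∈ D.graph ↔ (V η, V ζ) ∈ (multiplier F).graph)
    (g : G) (ξ : S) : ∃ h : V.symm (delta g ξ) ∈ D.domain,
      D ⟨_, h⟩ = V.symm (delta g ((F g : S →L[ℂ] S) ξ)) := by
  refine exists_domain_of_coord hD fun g' => ?_
  rw [V.apply_symm_apply, V.apply_symm_apply]
  exact (mem_graph_multiplier F).1 (delta_mem_graph_multiplier F g ξ) g'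

lemma dense_domain_of_graph
    (hD : ∀ η ζ, (η, ζ) ∈ D.graph ↔ (V η, V ζ) ∈ (multiplier F).graph) :
    Dense (D.domain : Set H) := by
  rw [Submodule.dense_iff_topologicalClosure_eq_top, eq_top_iff]
  intro z _
  have h := mem_of_delta_mem
    (K := D.domain.topologicalClosure.comap V.symm.toLinearEquiv.toLinearMap)
    ((Submodule.isClosed_topologicalClosure _).preimage V.symm.continuous)
    (fun g ξ => Submodule.le_topologicalClosure _ (exists_domain_delta hD g ξ).1) (V z)
  have h' : V.symm (V z) ∈ D.domain.topologicalClosure := h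
  rwa [V.symm_apply_apply] at h'

lemma inner_apply_selfAdjoint (T : selfAdjoint (S →L[ℂ] S)) (ξ η : S) :
    inner ℂ ((T : S →L[ℂ] S) ξ) η = inner ℂ ξ ((T : S →L[ℂ] S) η) := by
  have h := ContinuousLinearMap.adjoint_inner_left (T : S →L[ℂ] S) η ξ
  rwa [← ContinuousLinearMap.star_eq_adjoint, selfAdjoint.star_val_eq] at h

/-- Testing the adjoint against `δ_g ⊗ ξ` reads off its coordinates as `F(g) y_g`, so its graph lies
in that of `D` because the domain is maximal. The reverse inclusion is symmetry of each block. -/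
theorem isSelfAdjoint_of_graph [CompleteSpace H]
    (hD : ∀ η ζ, (η, ζ) ∈ D.graph ↔ (V η, V ζ) ∈ (multiplier F).graph) : IsSelfAdjoint D := by
  have hdense := dense_domain_of_graph hD
  rw [LinearPMap.isSelfAdjoint_def]
  refine le_antisymm (LinearPMap.le_of_le_graph ?_) (LinearPMap.IsFormalAdjoint.le_adjoint hdense ?_)
  · rintro ⟨y, w⟩ hyw
    obtain ⟨y', rfl, rfl⟩ := (LinearPMap.mem_graph_iff _).1 hyw
    refine (hD _ _).2 ((mem_graph_multiplier F).2 fun g => ext_inner_right ℂ fun ξ => ?_)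
    obtain ⟨hξ, hDξ⟩ := exists_domain_delta hD g ξ
    have h1 := LinearPMap.adjoint_isFormalAdjoint hdense y' ⟨_, hξ⟩
    rw [hDξ, ← V.inner_map_map, ← V.inner_map_map (y' : H), V.apply_symm_apply,
      V.apply_symm_apply, ← inner_conj_symm, inner_delta_left, inner_conj_symm,
      ← inner_conj_symm (V y'), inner_delta_left, inner_conj_symm] at h1
    rw [inner_apply_selfAdjoint]
    exact h1
  · intro x y
    rw [← V.inner_map_map, ← V.inner_map_map (x : H), lp.inner_eq_tsum, lp.inner_eq_tsum]
    refine tsum_congr fun g => ?_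
    rw [coord_of_graph hD, coord_of_graph hD, inner_apply_selfAdjoint]

/-- The resolvent at `i` is diagonal with blocks `(F(g) - i)⁻¹`, which are contractions whatever
`F(g)` is. -/
lemma exists_resolvent_of_graph
    (hD : ∀ η ζ, (η, ζ) ∈ D.graph ↔ (V η, V ζ) ∈ (multiplier F).graph) :
    ∃ R, IsResolvent D Complex.I R := by
  choose B hB hB1 hB2 using fun g => exists_inverse_sub_I (F g).2
  obtain ⟨T, hT⟩ := exists_diagonal B 1 hB
  refine ⟨V.symm.toContinuousLinearEquiv.toContinuousLinearMap.comp
    (T.comp V.toContinuousLinearEquiv.toContinuousLinearMap), fun x => ?_, fun η => ?_⟩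
  · change V.symm (T (V (D x - Complex.I • (x : H)))) = x
    rw [V.symm_apply_eq]
    ext g
    rw [hT, map_sub, map_smul]
    change B g (V (D x) g - Complex.I • V x g) = _
    rw [coord_of_graph hD, hB1]
  · have h1 : ∀ g, V (η + Complex.I • V.symm (T (V η))) g =
        (F g : S →L[ℂ] S) (V (V.symm (T (V η))) g) := by
      intro g
      rw [map_add, map_smul, V.apply_symm_apply]
      change V η g + Complex.I • T (V η) g = _
      rw [hT, ← sub_eq_iff_eq_add.1 (hB2 g (V η g))]
    obtain ⟨h, hDh⟩ := exists_domain_of_coord hD h1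
    exact ⟨⟨_, h⟩, rfl, by rw [hDh, add_sub_cancel_right]⟩

lemma isCompactOperator_resolvent_of_graph [FiniteDimensional ℂ S] [Nontrivial S] [CompleteSpace H]
    (hD : ∀ η ζ, (η, ζ) ∈ D.graph ↔ (V η, V ζ) ∈ (multiplier F).graph)
    (hF : FiniteSpectralMultiplicity F) {z : ℂ} {R : H →L[ℂ] H} (hR : IsResolvent D z R) :
    IsCompactOperator R := by
  have hcoord : ∀ η g, (F g : S →L[ℂ] S) (V (R η) g) - z • V (R η) g = V η g := by
    intro η g
    obtain ⟨x, hx, hxη⟩ := hR.2 η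
    rw [← hx, ← coord_of_graph hD]
    conv_rhs => rw [← hxη, map_sub, map_smul]
    rfl
  refine isClosed_setOfPred_isCompactOperator.closure_subset (Metric.mem_closure_iff.2 fun ε hε => ?_)
  -- Off the finitely many labels whose spectrum meets `[-r, r]`, the block `F(g) - z` is bounded
  -- below by `r - ‖z‖ = 2 / ε`. So `R` differs from its truncation by at most `ε / 2` in norm.
  let r : ℝ := ‖z‖ + 2 / ε
  have hr : 0 < r := by positivity
  have := hF r hr
  have hfin : {g : G | ∃ t ∈ Set.Icc (-r) r, (t : ℂ) ∈ spectrum ℂ (F g : S →L[ℂ] S)}.Finite :=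
    finite_of_finiteDimensional_directSum (ι := {g : G // ∃ t ∈ Set.Icc (-r) r,
      (t : ℂ) ∈ spectrum ℂ (F g : S →L[ℂ] S)}) (S := S)
  let Vc : H →L[ℂ] L2 G S := V.toContinuousLinearEquiv.toContinuousLinearMap
  let Vi : L2 G S →L[ℂ] H := V.symm.toContinuousLinearEquiv.toContinuousLinearMap
  refine ⟨Vi.comp ((truncation hfin.toFinset).comp (Vc.comp R)),
    ((isCompactOperator_truncation _).comp_clm (Vc.comp R)).clm_comp Vi, ?_⟩
  rw [dist_eq_norm]
  refine (ContinuousLinearMap.opNorm_le_bound _ (half_pos hε).le fun η => ?_).trans_lt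
    (half_lt_self hε)
  change ‖R η - V.symm (truncation hfin.toFinset (V (R η)))‖ ≤ _
  rw [← V.norm_map, map_sub, V.apply_symm_apply, ← V.norm_map η]
  refine norm_le_of_coord (half_pos hε).le fun g => ?_
  rw [lp.coeFn_sub, Pi.sub_apply]
  by_cases hg : g ∈ hfin.toFinset
  · rw [truncation_apply_of_mem _ hg, sub_self, norm_zero]
    positivity
  · rw [truncation_apply_of_notMem _ hg, sub_zero]
    have h1 := le_norm_apply_of_spectrum (F g).2 hr (by simpa using hg) (V (R η) g)
    have h2 := norm_sub_norm_le ((F g : S →L[ℂ] S) (V (R η) g)) (z • V (R η) g)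
    rw [hcoord, norm_smul] at h2
    have h3 : 2 / ε * ‖V (R η) g‖ ≤ ‖V η g‖ := by
      have : r * ‖V (R η) g‖ = ‖z‖ * ‖V (R η) g‖ + 2 / ε * ‖V (R η) g‖ := by
        simp only [r]; ring
      linarith
    calc ‖V (R η) g‖ = ε / 2 * (2 / ε * ‖V (R η) g‖) := by field_simp
      _ ≤ ε / 2 * ‖V η g‖ := mul_le_mul_of_nonneg_left h3 (half_pos hε).le

theorem hasCompactResolvent_of_graph [FiniteDimensional ℂ S] [Nontrivial S] [CompleteSpace H]
    (hD : ∀ η ζ, (η, ζ) ∈ D.graph ↔ (V η, V ζ) ∈ (multiplier F).graph)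
    (hF : FiniteSpectralMultiplicity F) : HasCompactResolvent D :=
  ⟨⟨Complex.I, exists_resolvent_of_graph hD⟩, fun _ _ hR =>
    isCompactOperator_resolvent_of_graph hD hF hR⟩

/-- Operators implementing phased translations preserve the domain and have bounded commutators. -/
lemma exists_commutator_of_phasedTranslation [AddCommGroup G]
    (hD : ∀ η ζ, (η, ζ) ∈ D.graph ↔ (V η, V ζ) ∈ (multiplier F).graph)
    (hF : BoundedTranslationIncrements F) {W : H →L[ℂ] H} {h : G}
    (hW : ∀ y : G, ∃ p : Circle, ∀ ξ : S,
      V (W (V.symm (delta y ξ))) = (p : ℂ) • delta (h + y) ξ) :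
    ∃ C : H →L[ℂ] H, ∀ x : D.domain, ∃ hx : W x ∈ D.domain, C x = D ⟨W x, hx⟩ - W (D x) := by
  choose p hp using hW
  obtain ⟨b, hb⟩ := hF h
  -- At the label `h + y`, `D W` uses the block `F(h + y)` and `W D` the block `F(y)`. The
  -- commutator is thus `W` composed with the diagonal operator of increments, bounded by (b).
  obtain ⟨T, hT⟩ := exists_diagonal (fun g => (F (g + h) : S →L[ℂ] S) - (F g : S →L[ℂ] S)) b
    fun g => hb ⟨g, rfl⟩
  let Vc : H →L[ℂ] L2 G S := V.toContinuousLinearEquiv.toContinuousLinearMap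
  let Vi : L2 G S →L[ℂ] H := V.symm.toContinuousLinearEquiv.toContinuousLinearMap
  have hWc : ∀ (η : H) (y : G), V (W η) (h + y) = (p y : ℂ) • V η y := by
    intro η y
    have h1 := pushforward_apply (add_right_injective h) (W := Vc.comp (W.comp Vi)) hp (V η) y
    change V (W (V.symm (V η))) (h + y) = _ at h1
    rwa [V.symm_apply_apply] at h1
  refine ⟨W.comp (Vi.comp (T.comp Vc)), fun x => ?_⟩
  have h1 : ∀ g, V (W (D x) + W (V.symm (T (V x)))) g = (F g : S →L[ℂ] S) (V (W x) g) := by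
    intro g
    obtain ⟨y, rfl⟩ : ∃ y, h + y = g := ⟨-h + g, add_neg_cancel_left h g⟩
    rw [map_add, lp.coeFn_add, Pi.add_apply, hWc, hWc, hWc, V.apply_symm_apply, hT,
      coord_of_graph hD, ← smul_add, map_smul, sub_apply, add_sub_cancel, add_comm y h]
  obtain ⟨hx, hDx⟩ := exists_domain_of_coord hD h1
  refine ⟨hx, ?_⟩
  rw [hDx, add_sub_cancel_left]
  rfl

end Diagonalized

/-! ### A linear space of elements with bounded commutators. -/

section Commutators

variable {A H : Type*} [CStarAlgebra A] [NormedAddCommGroup H] [InnerProductSpace ℂ H]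
  [CompleteSpace H] (π : A →⋆ₐ[ℂ] (H →L[ℂ] H)) (D : H →ₗ.[ℂ] H)

/-- The elements preserving the domain of `D` and having bounded commutator with `D`. -/
def smoothElements : Submodule ℂ A where
  carrier := {a | ∃ C : H →L[ℂ] H, ∀ x : D.domain, ∃ hx : π a x ∈ D.domain,
    C x = D ⟨π a x, hx⟩ - π a (D x)}
  zero_mem' := by
    refine ⟨0, fun x => ⟨by simp, ?_⟩⟩
    have h : ∀ h, D ⟨π 0 x, h⟩ = 0 := fun h => by
      rw [show (⟨π 0 x, h⟩ : D.domain) = 0 from Subtype.ext (by simp), LinearPMap.map_zero]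
    rw [h]
    simp
  add_mem' := by
    rintro a b ⟨C, hC⟩ ⟨C', hC'⟩
    refine ⟨C + C', fun x => ?_⟩
    obtain ⟨hx, h⟩ := hC x
    obtain ⟨hx', h'⟩ := hC' x
    have he : π (a + b) x = π a x + π b x := by rw [map_add, add_apply]
    refine ⟨he ▸ D.domain.add_mem hx hx', ?_⟩
    have h1 : ∀ h, D ⟨π (a + b) x, h⟩ = D ⟨π a x, hx⟩ + D ⟨π b x, hx'⟩ := fun h => by
      rw [← LinearPMap.map_add]
      congr 1
      exact Subtype.ext he
    rw [h1, add_apply, h, h', map_add, add_apply]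
    abel
  smul_mem' := by
    rintro c a ⟨C, hC⟩
    refine ⟨c • C, fun x => ?_⟩
    obtain ⟨hx, h⟩ := hC x
    have he : π (c • a) x = c • π a x := by rw [map_smul, smul_apply]
    refine ⟨he ▸ D.domain.smul_mem c hx, ?_⟩
    have h1 : ∀ h, D ⟨π (c • a) x, h⟩ = c • D ⟨π a x, hx⟩ := fun h => by
      rw [← LinearPMap.map_smul]
      congr 1
      exact Subtype.ext he
    rw [h1, smul_apply, h, map_smul, smul_apply, smul_sub]

variable {π D}

/-- `boundedCommutators` is not visibly closed under sums, because the commutator domain depends on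
the element. Preserving the whole of `Dom D` is a linear condition, so it can be checked on
monomials. -/
lemma smoothElements_subset (hD : Dense (D.domain : Set H)) :
    (smoothElements π D : Set A) ⊆ boundedCommutators π D := by
  rintro a ⟨C, hC⟩
  refine ⟨hD.mono fun x hx => ⟨hx, (hC ⟨x, hx⟩).1⟩, C, fun x hx hx' => ?_⟩
  exact (hC ⟨x, hx⟩).2

end Commutators

/-! ### The inductive realization -/

/-- Bounded commutators on a total family give a dense set of elements with bounded commutators. -/
lemma dense_boundedCommutators_of_total {A X : ℕ → Type*} {B H : Type*} [∀ n, CStarAlgebra (A n)]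
    [CStarAlgebra B] [NormedAddCommGroup H] [InnerProductSpace ℂ H] [CompleteSpace H]
    {ι : ∀ n, A n →⋆ₐ[ℂ] B} (hι : Dense (⋃ n, Set.range (ι n))) {u : ∀ n, X n → A n}
    (hu : ∀ n, Dense (Submodule.span ℂ (Set.range (u n)) : Set (A n)))
    {π : B →⋆ₐ[ℂ] (H →L[ℂ] H)} {D : H →ₗ.[ℂ] H} (hD : Dense (D.domain : Set H))
    (h : ∀ n x, ι n (u n x) ∈ smoothElements π D) : Dense (boundedCommutators π D) := by
  refine Dense.mono (smoothElements_subset hD) (dense_closure.1 (hι.mono ?_))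
  refine Set.iUnion_subset fun n => ?_
  rintro _ ⟨a, rfl⟩
  have h1 : Submodule.span ℂ (Set.range (u n)) ≤
      (smoothElements π D).comap (starHomCLM (ι n)).toLinearMap := by
    rw [Submodule.span_le]
    rintro _ ⟨x, rfl⟩
    exact h n x
  exact map_mem_closure (starHomCLM (ι n)).continuous (hu n a) h1

namespace ToricSystem

variable {T : ToricSystem} {S : Type} [NormedAddCommGroup S] [InnerProductSpace ℂ S]
  [CompleteSpace S] {I : ∀ n, T.H S n →ₗᵢ[ℂ] T.H S (n + 1)}

section Abstract

variable {A : ℕ → Type*} {B : Type*} [∀ n, CStarAlgebra (A n)] [CStarAlgebra B]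
  {φ : ∀ n, A n →⋆ₐ[ℂ] A (n + 1)} {u : ∀ n, T.Label n → A n} {ι : ∀ n, A n →⋆ₐ[ℂ] B}

/-- The algebra counterpart of `IsGNSIsometry.exists_limit_phase`: it brings a monomial to the stage
where a given label of `G_∞` is represented. -/
lemma exists_stage_phase
    (hu : ∀ n x, ∃ c : Circle, φ n (u n x) = (c : ℂ) • u (n + 1) ((T.M n).mulVec x))
    (hι : ∀ n a, ι (n + 1) (φ n a) = ι n a) (n k : ℕ) (h : n ≤ k) (x : T.Label n) :
    ∃ c : Circle, ι n (u n x) = (c : ℂ) • ι k (u k (T.labelTransition n k h x)) := by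
  induction k, h using Nat.le_induction with
  | base => exact ⟨1, by simp [labelTransition]⟩
  | succ k h ih =>
    obtain ⟨c, hc⟩ := ih
    obtain ⟨c', hc'⟩ := hu k (T.labelTransition n k h x)
    refine ⟨c * c', ?_⟩
    rw [hc, ← hι, hc', map_smul, smul_smul, Circle.coe_mul, T.labelTransition_succ n k h]
    rfl

variable {V : HilbertLimit I ≃ₗᵢ[ℂ] L2 T.G S} {χ : ∀ n, T.Label n → Circle}
  {ρ : ∀ n, A n →⋆ₐ[ℂ] (T.H S n →L[ℂ] T.H S n)}

/-- In `ℓ²(G_∞) ⊗ S` the monomial `ι_n(U^x)` acts as a phased translation by `[x, n]`. -/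
lemma exists_phase_limitRep
    (hu : ∀ n x, ∃ c : Circle, φ n (u n x) = (c : ℂ) • u (n + 1) ((T.M n).mulVec x))
    (hι : ∀ n a, ι (n + 1) (φ n a) = ι n a) (hρ : ∀ n x, IsPhasedTranslation x (ρ n (u n x)))
    {π : B →⋆ₐ[ℂ] (HilbertLimit I →L[ℂ] HilbertLimit I)}
    (hπ : ∀ n a η, π (ι n a) (toHilbertLimit I n η) = toHilbertLimit I n (ρ n a η))
    (hV : ∀ n (x : T.Label n) (ξ : S),
      V (toHilbertLimit I n (delta x ξ)) = (χ n x : ℂ) • delta (T.label n x) ξ)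
    (n : ℕ) (x : T.Label n) (g : T.G) : ∃ p : Circle, ∀ ξ : S,
      V (π (ι n (u n x)) (V.symm (delta g ξ))) = (p : ℂ) • delta (T.label n x + g) ξ := by
  obtain ⟨l, y₀, rfl⟩ := T.exists_label g
  -- A common stage for `x` and for the label `g`, where the action is that of `ρ k` on a single
  -- `δ_y`.
  obtain ⟨k, hnk, y, hy⟩ : ∃ k, ∃ _ : n ≤ k, ∃ y, T.label k y = T.label l y₀ :=
    ⟨max n l, le_max_left _ _, _, T.label_transition (le_max_right n l) y₀⟩
  rw [← hy]
  obtain ⟨c, hc⟩ := exists_stage_phase hu hι n k hnk x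
  obtain ⟨q, hq⟩ := hρ k (T.labelTransition n k hnk x) y
  refine ⟨(χ k y)⁻¹ * (c * (q * χ k (T.labelTransition n k hnk x + y))), fun ξ => ?_⟩
  have h1 : V.symm (delta (T.label k y) ξ) =
      (((χ k y)⁻¹ : Circle) : ℂ) • toHilbertLimit I k (delta y ξ) := by
    rw [V.symm_apply_eq, map_smul, hV, smul_smul, ← Circle.coe_mul, inv_mul_cancel,
      Circle.coe_one, one_smul]
  have h2 : π ((c : ℂ) • ι k (u k (T.labelTransition n k hnk x))) =
      (c : ℂ) • π (ι k (u k (T.labelTransition n k hnk x))) := map_smul π _ _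
  rw [h1, hc, h2, map_smul, smul_apply, hπ, hq, map_smul, map_smul, map_smul, map_smul, hV,
    T.label_add, T.label_transition]
  simp only [smul_smul, Circle.coe_mul]

/-- All that is needed of the stage algebras is a total family of elements indexed by labels,
carried to one another up to phases and acting as phased translations in faithful representations.
-/
lemma isSpectralTriple_cstarLimit [FiniteDimensional ℂ S] [Nontrivial S]
    (hu : ∀ n x, ∃ c : Circle, φ n (u n x) = (c : ℂ) • u (n + 1) ((T.M n).mulVec x))
    (hdense : ∀ n, Dense (Submodule.span ℂ (Set.range (u n)) : Set (A n)))
    (hρ : ∀ n x, IsPhasedTranslation x (ρ n (u n x))) (hinj : ∀ n, Function.Injective (ρ n))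
    {π : CStarLimit φ →⋆ₐ[ℂ] (HilbertLimit I →L[ℂ] HilbertLimit I)}
    (hπ : ∀ n (a : A n) (η : T.H S n),
      π (toCStarLimit φ n a) (toHilbertLimit I n η) = toHilbertLimit I n (ρ n a η))
    (hV : ∀ n (x : T.Label n) (ξ : S),
      V (toHilbertLimit I n (delta x ξ)) = (χ n x : ℂ) • delta (T.label n x) ξ)
    {D : HilbertLimit I →ₗ.[ℂ] HilbertLimit I} {Finf : T.G → selfAdjoint (S →L[ℂ] S)}
    (hD : ∀ η ζ, (η, ζ) ∈ D.graph ↔ (V η, V ζ) ∈ (multiplier Finf).graph)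
    (hF_mult : FiniteSpectralMultiplicity Finf) (hF_incr : BoundedTranslationIncrements Finf) :
    IsSpectralTriple (A := CStarLimit φ) π D where
  faithful := limitRep_injective hinj hπ
  dense_domain := dense_domain_of_graph hD
  selfAdjoint := isSelfAdjoint_of_graph hD
  compactResolvent := hasCompactResolvent_of_graph hD hF_mult
  dense_boundedCommutators :=
    dense_boundedCommutators_of_total (dense_iUnion_range_toCStarLimit φ) hdense
      (dense_domain_of_graph hD) fun n x => exists_commutator_of_phasedTranslation hD hF_incr
        (exists_phase_limitRep hu (toCStarLimit_comp φ) hρ hπ hV n x)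

end Abstract

variable [Nontrivial S]

theorem IsGNSIsometry.existsUnique_isLimitRep (hI : T.IsGNSIsometry I) :
    ∃! π : T.Apro →⋆ₐ[ℂ] (HilbertLimit I →L[ℂ] HilbertLimit I), T.IsLimitRep I π := by
  have : Nontrivial (T.H S 0) := (deltaIsometry S (0 : T.Label 0)).injective.nontrivial
  exact existsUnique_limitRep (φ := T.φ) (ρ := T.π S) hI.map_rep

theorem IsLimitRep.isSpectralTriple [FiniteDimensional ℂ S]
    {π : T.Apro →⋆ₐ[ℂ] (HilbertLimit I →L[ℂ] HilbertLimit I)} (hπ : T.IsLimitRep I π)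
    {V : HilbertLimit I ≃ₗᵢ[ℂ] L2 T.G S} {χ : ∀ n, T.Label n → Circle}
    (hV : ∀ n (x : T.Label n) (ξ : S),
      V (toHilbertLimit I n (delta x ξ)) = (χ n x : ℂ) • delta (T.label n x) ξ)
    {D : HilbertLimit I →ₗ.[ℂ] HilbertLimit I} {Finf : T.G → selfAdjoint (S →L[ℂ] S)}
    (hD : ∀ η ζ, (η, ζ) ∈ D.graph ↔ (V η, V ζ) ∈ (multiplier Finf).graph)
    (hF_mult : FiniteSpectralMultiplicity Finf) (hF_incr : BoundedTranslationIncrements Finf) :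
    IsSpectralTriple (A := T.Apro) π D :=
  isSpectralTriple_cstarLimit (φ := T.φ) (ρ := T.π S) (u := fun n => NCTorus.mono (T.Θ n))
    (fun n => exists_toricHom_mono (T.z n) (T.congruence n))
    (fun n => NCTorus.dense_span_mono (T.Θ n)) (fun n => regularRep_mono (T.skew n) S)
    (fun n => regularRep_injective (T.skew n)) hπ hV hD hF_mult hF_incr

end ToricSystem

end Protorus

end

open Protorus in
theorem mainTheorem11 (T : ToricSystem)
    (S : Type) [NormedAddCommGroup S] [InnerProductSpace ℂ S] [CompleteSpace S]
    [FiniteDimensional ℂ S] [Nontrivial S]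
    (F : ∀ n, T.Label n → selfAdjoint (S →L[ℂ] S))
    (hF_mult : ∀ n, FiniteSpectralMultiplicity (F n))
    (hF_incr : ∀ n, BoundedTranslationIncrements (F n))
    (hF_compat : ∀ n (x : T.Label n), F (n + 1) ((T.M n).mulVec x) = F n x)
    (h_smooth : ∀ n (a : T.A n), a ∈ boundedCommutators (T.π S n) (multiplier (F n)) →
      T.φ n a ∈ boundedCommutators (T.π S (n + 1)) (multiplier (F (n + 1)))) :
    ∃ Finf : T.G → selfAdjoint (S →L[ℂ] S),
      (∀ n (x : T.Label n), Finf (T.label n x) = F n x) ∧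
      (∃! I : ∀ n, T.H S n →ₗᵢ[ℂ] T.H S (n + 1), T.IsGNSIsometry I) ∧
      ∀ I : ∀ n, T.H S n →ₗᵢ[ℂ] T.H S (n + 1), T.IsGNSIsometry I →
        LimitOperatorWellDefined I (fun n => multiplier (F n)) ∧
        (∃ (V : HilbertLimit I ≃ₗᵢ[ℂ] L2 T.G S) (χ : ∀ n, T.Label n → Circle),
          (∀ n (x : T.Label n) (ξ : S),
            V (toHilbertLimit I n (delta x ξ)) = (χ n x : ℂ) • delta (T.label n x) ξ) ∧
          ∀ η ζ : HilbertLimit I,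
            (η, ζ) ∈ (limitOperator I fun n => multiplier (F n)).graph ↔
              (V η, V ζ) ∈ (multiplier Finf).graph) ∧
        (∃! π : T.Apro →⋆ₐ[ℂ] (HilbertLimit I →L[ℂ] HilbertLimit I), T.IsLimitRep I π) ∧
        ∀ π : T.Apro →⋆ₐ[ℂ] (HilbertLimit I →L[ℂ] HilbertLimit I), T.IsLimitRep I π →
          FiniteSpectralMultiplicity Finf → BoundedTranslationIncrements Finf →
            IsSpectralTriple (A := T.Apro) π (limitOperator I fun n => multiplier (F n)) := by
  refine (T.exists_limit_function F hF_compat).imp fun Finf hFinf => ⟨hFinf, ?_, fun I hI => ?_⟩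
  · exact T.exists_isGNSIsometry.imp fun I hI => ⟨hI, fun I' hI' => hI'.eq hI⟩
  · refine hI.exists_unitary.elim fun V hV => hV.elim fun χ hV => ?_
    have hD := ToricSystem.mem_graph_limitOperator hV hFinf
    refine ⟨ToricSystem.limitOperatorWellDefined hV hFinf, ⟨V, χ, hV, hD⟩,
      hI.existsUnique_isLimitRep, fun π hπ hF_mult' hF_incr' => ?_⟩
    exact hπ.isSpectralTriple hV hD hF_mult' hF_incr'
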